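/- Let $\Omega\subset\mathbb R^d$ be a bounded domain (nonempty, open, connected) with $C^\infty$ boundary, let $T>0$ and let $k\ge 0$ be an integer. Then there is a constant $C>0$, depending only on $d$, $\Omega$, $T$ and $k$, with the following property. Let $\sigma\in C^\infty(\mathbb R)$ be any activation function that is not a polynomial, let $f\in C^{k+1}([0,T]\times\overline\Omega)$, and let $N\ge 1$ be an integer. Then there is a function $\phi_N$ represented by a deep feedforward neural network with activation $\sigma$ (with $d+1$ inputs $(t,x)$, one real output, an affine output layer and at least two hidden layers) of complexity $N$, meaning that exactly $N$ of its weights and biases are nonzero, such that $$\|f-\phi_N\|_{W^{k,\infty}([0,T]\times\overline\Omega)}\le \frac{C}{N^{\frac1{d+1}}}\,\|f\|_{W^{k+1,\infty}([0,T]\times\overline\Omega)} .$$ Here $\|u\|_{W^{j,\infty}([0,T]\times\overline\Omega)}=\max_{|\alpha|\le j}\|D^\alpha u\|_{L^\infty((0,T)\times\Omega)}$, where $\alpha$ runs over the space-time multi-indices of order at most $j$ and $D^\alpha$ is the weak derivative. -/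

import Mathlib

open Set MeasureTheory
open scoped ContDiff ENNReal Topology

/-- A point `(t, x)` of space-time `ℝ × ℝ^d`. -/
abbrev SpaceTime (d : ℕ) : Type := ℝ × EuclideanSpace ℝ (Fin d)

/-- A bounded domain (nonempty, open, connected) of `ℝ^d` with `C^∞` boundary: near each boundary
point, `Ω` is the sublevel set `{ρ < 0}` of a smooth function whose differential does not vanish at
that point. -/
structure IsSmoothBoundedDomain {d : ℕ} (Ω : Set (EuclideanSpace ℝ (Fin d))) : Prop where
  isOpen : IsOpen Ω
  isConnected : IsConnected Ω
  isBounded : Bornology.IsBounded Ω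
  smooth_boundary : ∀ x ∈ frontier Ω, ∃ U : Set (EuclideanSpace ℝ (Fin d)), IsOpen U ∧ x ∈ U ∧
    ∃ ρ : EuclideanSpace ℝ (Fin d) → ℝ, ContDiffOn ℝ ∞ ρ U ∧ fderiv ℝ ρ x ≠ 0 ∧
      Ω ∩ U = {y ∈ U | ρ y < 0}

/-- The coordinate directions of space-time: direction `0` is time, direction `i + 1` is the `i`-th
space coordinate. -/
noncomputable def coordDir (d : ℕ) : Fin (d + 1) → SpaceTime d :=
  Fin.cons (1, 0) (fun i => (0, EuclideanSpace.single i 1))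

/-- `v` is the weak partial derivative `∂_{ι 0} ⋯ ∂_{ι (n-1)} u` of `u` on the open set `Q`. A
multi-index of order `n` is given by a tuple `ι` listing its `n` coordinate directions. -/
def IsWeakDeriv {d : ℕ} (Q : Set (SpaceTime d)) {n : ℕ} (ι : Fin n → Fin (d + 1))
    (u v : SpaceTime d → ℝ) : Prop :=
  LocallyIntegrableOn u Q volume ∧ LocallyIntegrableOn v Q volume ∧
    ∀ η : SpaceTime d → ℝ, ContDiff ℝ ∞ η → HasCompactSupport η → tsupport η ⊆ Q →
      ∫ z in Q, u z * iteratedFDeriv ℝ n η z (fun i => coordDir d (ι i)) =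
        (-1) ^ n * ∫ z in Q, v z * η z

/-- The `W^{k,∞}(Q)` norm `max_{|α| ≤ k} ‖D^α u‖_{L^∞(Q)}`, with weak derivatives `D^α u`. Weak
derivatives are unique up to null sets, so the infimum is over at most one class; it is `∞` if the
weak derivative does not exist. -/
noncomputable def sobolevNorm {d : ℕ} (k : ℕ) (Q : Set (SpaceTime d)) (u : SpaceTime d → ℝ) :
    ℝ≥0∞ :=
  ⨆ (n : ℕ) (_ : n ≤ k) (ι : Fin n → Fin (d + 1)),
    ⨅ (v : SpaceTime d → ℝ) (_ : IsWeakDeriv Q ι u v), eLpNorm v ∞ (volume.restrict Q)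

/-- Fully connected feedforward neural networks with `n` inputs and one real output: finitely many
hidden layers, each with a weight matrix and a bias vector, and then an affine output layer. -/
inductive NeuralNetwork : ℕ → Type
  | output {n : ℕ} (w : Fin n → ℝ) (b : ℝ) : NeuralNetwork n
  | hidden {n m : ℕ} (W : Matrix (Fin m) (Fin n) ℝ) (b : Fin m → ℝ) (rest : NeuralNetwork m) :
      NeuralNetwork n

namespace NeuralNetwork

/-- The function realized by a network with activation function `σ`, applied componentwise in
every hidden layer. -/
def eval (σ : ℝ → ℝ) : {n : ℕ} → NeuralNetwork n → (Fin n → ℝ) → ℝ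
  | _, output w b, x => w ⬝ᵥ x + b
  | _, hidden W b rest, x => rest.eval σ (fun i => σ (W.mulVec x i + b i))

/-- The number of hidden layers. -/
def depth : {n : ℕ} → NeuralNetwork n → ℕ
  | _, output _ _ => 0
  | _, hidden _ _ rest => rest.depth + 1

/-- The complexity of a network: the total number of its nonzero weights and biases. -/
noncomputable def complexity : {n : ℕ} → NeuralNetwork n → ℕ
  | _, output w b => Set.ncard {j | w j ≠ 0} + (open Classical in if b = 0 then 0 else 1)
  | _, hidden W b rest =>
      Set.ncard {p : _ × _ | W p.1 p.2 ≠ 0} + Set.ncard {i | b i ≠ 0} + rest.complexity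

/-- The function of `(t, x) = (t, x_1, …, x_d)` realized by a network with `d + 1` inputs. -/
def realize {d : ℕ} (σ : ℝ → ℝ) (Φ : NeuralNetwork (d + 1)) (z : SpaceTime d) : ℝ :=
  Φ.eval σ (Fin.cons z.1 (fun i => z.2 i))

end NeuralNetwork

/-!
Extend `f` from the cylinder `[0,T] × closure Ω` to a compactly supported function on all of
space-time with control of `k + 1` derivatives: near a boundary point where `Ω = {ρ < 0}`, a
weighted sum of the values of `f` at the points `x - λ ρ(x) e`, with weights matching enough moments
in `λ`, continues `f` across `{ρ = 0}`, and a partition of unity glues the pieces. Convolving the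
extension with a product of polynomial kernels concentrated at scale `1 / n` gives a polynomial of
degree at most `8 n` in each coordinate whose `C^k` distance to `f` is `O(1 / n)`.

Since `σ` is not a polynomial, there is a point `b₀` at which all the derivatives needed are
nonzero. The coefficient of a monomial in the Taylor expansion of `σ (b₀ + ε ⟪t, x⟫)` is isolated
by a combination over tensor products `t` of fixed nodes, so as `ε → 0` such combinations reproduce
every monomial. All monomials share the same `(8 n + 1)^(d + 1)` neurons, whose number does not
depend on the accuracy, and as `σ (b₀ + δ y)` is affine in `y` to first order in `δ`, a second
hidden layer needs only one neuron to pass the result on. Hence about `n^(d + 1)` parameters give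
an error `O(1 / n)`; idle neurons, each with a single nonzero bias, adjust the complexity to be
exactly `N`.
-/

/-! ### Functions with bounded derivatives along a family of directions -/

section BoundedDerivs

variable {V : Type*} [NormedAddCommGroup V] [NormedSpace ℝ V] {ι : Type*}

/-- The functions of class `C^m` within `S` whose iterated partial derivatives of order at most `m`
along the directions `dir i` are continuous on `S` and bounded there by `M`. Derivatives within `S`
need not be unique; some choice of them has to satisfy the bounds. -/
def BoundedDerivs (dir : ι → V) (S : Set V) (M : ℝ) : ℕ → (V → ℝ) → Prop
  | 0, f => ContinuousOn f S ∧ ∀ x ∈ S, |f x| ≤ M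
  | m + 1, f => (∀ x ∈ S, |f x| ≤ M) ∧ ∃ f' : V → V →L[ℝ] ℝ,
      (∀ x ∈ S, HasFDerivWithinAt f (f' x) S x) ∧
        ∀ i, BoundedDerivs dir S M m (fun x => f' x (dir i))

theorem continuousOn_cutoff_mul {X : Type*} [TopologicalSpace X] {S U : Set X} {χ f : X → ℝ}
    (hU : IsOpen U) (hχU : tsupport χ ⊆ U) (hχ : ContinuousOn χ S) (hf : ContinuousOn f (S ∩ U)) :
    ContinuousOn (fun x => χ x * f x) S := by
  intro x hx
  by_cases hxU : x ∈ U
  · exact (continuousWithinAt_inter (hU.mem_nhds hxU)).1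
      (((hχ.mono inter_subset_left).mul hf) x ⟨hx, hxU⟩)
  · have hχ0 := notMem_tsupport_iff_eventuallyEq.1 fun h => hxU (hχU h)
    refine (continuousAt_const (y := (0 : ℝ))).congr ?_ |>.continuousWithinAt
    filter_upwards [hχ0] with y hy
    simp only [hy, Pi.zero_apply, zero_mul]

theorem abs_cutoff_mul_le {X : Type*} [TopologicalSpace X] {S U : Set X} {χ f : X → ℝ} {M A : ℝ}
    (hM : 0 ≤ M) (hA : 0 ≤ A) (hχU : tsupport χ ⊆ U) (hχ : ∀ x ∈ S, |χ x| ≤ A)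
    (hf : ∀ x ∈ S ∩ U, |f x| ≤ M) {x : X} (hx : x ∈ S) : |χ x * f x| ≤ A * M := by
  rw [abs_mul]
  by_cases hxU : x ∈ U
  · exact mul_le_mul (hχ x hx) (hf x ⟨hx, hxU⟩) (abs_nonneg _) hA
  · rw [image_eq_zero_of_notMem_tsupport fun h => hxU (hχU h), abs_zero, zero_mul]
    positivity

theorem hasFDerivWithinAt_cutoff_mul {S U : Set V} {χ f : V → ℝ} {χ' f' : V → V →L[ℝ] ℝ}
    (hU : IsOpen U) (hχU : tsupport χ ⊆ U) (hχ : ∀ x, HasFDerivAt χ (χ' x) x)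
    (hf : ∀ x ∈ S ∩ U, HasFDerivWithinAt f (f' x) (S ∩ U) x) {x : V} (hx : x ∈ S) :
    HasFDerivWithinAt (fun x => χ x * f x) (χ x • f' x + f x • χ' x) S x := by
  by_cases hxU : x ∈ U
  · exact (hasFDerivWithinAt_inter (hU.mem_nhds hxU)).1
      ((hχ x).hasFDerivWithinAt.mul (hf x ⟨hx, hxU⟩))
  · have hχ0 : χ =ᶠ[𝓝 x] 0 := notMem_tsupport_iff_eventuallyEq.1 fun h => hxU (hχU h)
    have hχ'0 : χ' x = 0 := (hχ x).unique ((hasFDerivAt_const 0 x).congr_of_eventuallyEq hχ0)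
    rw [hχ0.eq_of_nhds, hχ'0, Pi.zero_apply, zero_smul, smul_zero, add_zero]
    refine ((hasFDerivAt_const (0 : ℝ) x).congr_of_eventuallyEq ?_).hasFDerivWithinAt
    filter_upwards [hχ0] with y hy
    simp only [hy, Pi.zero_apply, zero_mul]

namespace BoundedDerivs

variable {dir : ι → V} {S S' : Set V} {M M' A : ℝ} {m : ℕ} {f g : V → ℝ}

theorem abs_le (h : BoundedDerivs dir S M m f) : ∀ x ∈ S, |f x| ≤ M := by
  cases m with
  | zero => exact h.2
  | succ m => exact h.1

theorem continuousOn (h : BoundedDerivs dir S M m f) : ContinuousOn f S := by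
  cases m with
  | zero => exact h.1
  | succ m =>
    obtain ⟨_, f', hf', _⟩ := h
    exact fun x hx => (hf' x hx).continuousWithinAt

theorem mono_bound (h : BoundedDerivs dir S M m f) (hM : M ≤ M') : BoundedDerivs dir S M' m f := by
  induction m generalizing f with
  | zero => exact ⟨h.1, fun x hx => (h.2 x hx).trans hM⟩
  | succ m ih =>
    obtain ⟨hfM, f', hf', hi⟩ := h
    exact ⟨fun x hx => (hfM x hx).trans hM, f', hf', fun i => ih (hi i)⟩

theorem mono_set (h : BoundedDerivs dir S M m f) (hS : S' ⊆ S) : BoundedDerivs dir S' M m f := by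
  induction m generalizing f with
  | zero => exact ⟨h.1.mono hS, fun x hx => h.2 x (hS hx)⟩
  | succ m ih =>
    obtain ⟨hfM, f', hf', hi⟩ := h
    exact ⟨fun x hx => hfM x (hS hx), f', fun x hx => (hf' x (hS hx)).mono hS, fun i => ih (hi i)⟩

theorem of_succ (h : BoundedDerivs dir S M (m + 1) f) : BoundedDerivs dir S M m f := by
  induction m generalizing f with
  | zero => exact ⟨h.continuousOn, h.abs_le⟩
  | succ m ih =>
    obtain ⟨hfM, f', hf', hi⟩ := h
    exact ⟨hfM, f', hf', fun i => ih (hi i)⟩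

theorem congr (h : BoundedDerivs dir S M m f) (hfg : EqOn g f S) : BoundedDerivs dir S M m g := by
  cases m with
  | zero => exact ⟨h.1.congr hfg, fun x hx => hfg hx ▸ h.2 x hx⟩
  | succ m =>
    obtain ⟨hfM, f', hf', hi⟩ := h
    exact ⟨fun x hx => hfg hx ▸ hfM x hx, f', fun x hx => (hf' x hx).congr hfg (hfg hx), hi⟩

theorem const (c : ℝ) (hc : |c| ≤ M) : BoundedDerivs dir S M m (fun _ => c) := by
  have hM : 0 ≤ M := (abs_nonneg c).trans hc
  induction m generalizing c with
  | zero => exact ⟨continuousOn_const, fun _ _ => hc⟩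
  | succ m ih =>
    exact ⟨fun _ _ => hc, fun _ => 0, fun x _ => hasFDerivWithinAt_const c x S,
      fun i => by simpa using ih 0 (by simpa using hM)⟩

theorem add (hf : BoundedDerivs dir S M m f) (hg : BoundedDerivs dir S A m g) :
    BoundedDerivs dir S (M + A) m (fun x => f x + g x) := by
  induction m generalizing f g with
  | zero =>
    exact ⟨hf.1.add hg.1, fun x hx => (abs_add_le _ _).trans (add_le_add (hf.2 x hx) (hg.2 x hx))⟩
  | succ m ih =>
    obtain ⟨hfM, f', hf', hfi⟩ := hf
    obtain ⟨hgA, g', hg', hgi⟩ := hg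
    exact ⟨fun x hx => (abs_add_le _ _).trans (add_le_add (hfM x hx) (hgA x hx)),
      fun x => f' x + g' x, fun x hx => (hf' x hx).add (hg' x hx), fun i => ih (hfi i) (hgi i)⟩

theorem const_mul (hf : BoundedDerivs dir S M m f) (c : ℝ) :
    BoundedDerivs dir S (|c| * M) m (fun x => c * f x) := by
  have habs : ∀ {m f}, BoundedDerivs dir S M m f → ∀ x ∈ S, |c * f x| ≤ |c| * M :=
    fun hf x hx => by
      rw [abs_mul]
      exact mul_le_mul_of_nonneg_left (hf.abs_le x hx) (abs_nonneg c)
  induction m generalizing f with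
  | zero => exact ⟨continuousOn_const.mul hf.1, habs hf⟩
  | succ m ih =>
    obtain ⟨_, f', hf', hi⟩ := id hf
    exact ⟨habs hf, fun x => c • f' x, fun x hx => (hf' x hx).const_mul c, fun i => ih (hi i)⟩

theorem neg (hf : BoundedDerivs dir S M m f) : BoundedDerivs dir S M m (fun x => -f x) := by
  simpa using hf.const_mul (-1)

theorem sub (hf : BoundedDerivs dir S M m f) (hg : BoundedDerivs dir S A m g) :
    BoundedDerivs dir S (M + A) m (fun x => f x - g x) := by
  simpa [sub_eq_add_neg] using hf.add hg.neg

theorem sum {κ : Type*} (s : Finset κ) {F : κ → V → ℝ} {B : κ → ℝ}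
    (h : ∀ j ∈ s, BoundedDerivs dir S (B j) m (F j)) :
    BoundedDerivs dir S (∑ j ∈ s, B j) m (fun x => ∑ j ∈ s, F j x) := by
  classical
  induction s using Finset.induction_on with
  | empty => simpa using const (dir := dir) (S := S) (m := m) (M := 0) 0 (by simp)
  | insert a s ha ih =>
    simp only [Finset.sum_insert ha]
    exact (h a (Finset.mem_insert_self a s)).add
      (ih fun j hj => h j (Finset.mem_insert_of_mem hj))

theorem cutoff_mul {U : Set V} {χ : V → ℝ} (hM : 0 ≤ M) (hA : 0 ≤ A) (hU : IsOpen U)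
    (hχU : tsupport χ ⊆ U) (hχ : BoundedDerivs dir univ A m χ)
    (hf : BoundedDerivs dir (S ∩ U) M m f) :
    BoundedDerivs dir S (2 ^ m * (A * M)) m (fun x => χ x * f x) := by
  have habs : ∀ {m χ f}, tsupport χ ⊆ U → BoundedDerivs dir univ A m χ →
      BoundedDerivs dir (S ∩ U) M m f → ∀ x ∈ S, |χ x * f x| ≤ 2 ^ m * (A * M) :=
    fun hχU hχ hf x hx =>
      (abs_cutoff_mul_le hM hA hχU (fun x _ => hχ.abs_le x trivial) hf.abs_le hx).trans
        (le_mul_of_one_le_left (mul_nonneg hA hM) (one_le_pow₀ one_le_two))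
  induction m generalizing f χ with
  | zero =>
    exact ⟨continuousOn_cutoff_mul hU hχU (hχ.1.mono (subset_univ S)) hf.1, habs hχU hχ hf⟩
  | succ m ih =>
    obtain ⟨_, f', hf', hfi⟩ := id hf
    obtain ⟨_, χ', hχ', hχi⟩ := id hχ
    simp only [mem_univ, hasFDerivWithinAt_univ, forall_const] at hχ'
    have hχ'U : ∀ i, tsupport (fun x => χ' x (dir i)) ⊆ U := fun i => by
      rw [show χ' = fderiv ℝ χ from funext fun x => (hχ' x).fderiv.symm]
      exact (tsupport_fderiv_apply_subset ℝ (dir i)).trans hχU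
    refine ⟨habs hχU hχ hf, fun x => χ x • f' x + f x • χ' x,
      fun x hx => hasFDerivWithinAt_cutoff_mul hU hχU hχ' hf' hx, fun i => ?_⟩
    have h := (ih hχU hχ.of_succ (hfi i)).add (ih (hχ'U i) (hχi i) hf.of_succ)
    refine (h.mono_bound (le_of_eq (by ring))).congr fun x _ => ?_
    simp [mul_comm]

theorem mul (hM : 0 ≤ M) (hA : 0 ≤ A) (hf : BoundedDerivs dir S M m f)
    (hg : BoundedDerivs dir S A m g) :
    BoundedDerivs dir S (2 ^ m * (M * A)) m (fun x => f x * g x) := by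
  induction m generalizing f g with
  | zero =>
    exact ⟨hf.1.mul hg.1, fun x hx => by
      rw [abs_mul, pow_zero, one_mul]
      exact mul_le_mul (hf.2 x hx) (hg.2 x hx) (abs_nonneg _) hM⟩
  | succ m ih =>
    obtain ⟨hfM, f', hf', hfi⟩ := id hf
    obtain ⟨hgA, g', hg', hgi⟩ := id hg
    refine ⟨fun x hx => ?_, fun x => f x • g' x + g x • f' x,
      fun x hx => (hf' x hx).mul (hg' x hx), fun i => ?_⟩
    · rw [abs_mul]
      exact (mul_le_mul (hfM x hx) (hgA x hx) (abs_nonneg _) hM).trans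
        (le_mul_of_one_le_left (mul_nonneg hM hA) (one_le_pow₀ one_le_two))
    · have h := (ih hf.of_succ (hgi i)).add (ih (hfi i) hg.of_succ)
      refine (h.mono_bound (le_of_eq (by ring))).congr fun x _ => ?_
      simp [mul_comm]

theorem exists_uniform_bound {κ : Type*} [Finite κ] {F : κ → V → ℝ}
    (h : ∀ j, ∃ A, 0 ≤ A ∧ BoundedDerivs dir S A m (F j)) :
    ∃ A, 0 ≤ A ∧ ∀ j, BoundedDerivs dir S A m (F j) := by
  cases nonempty_fintype κ
  choose A hA₀ hA using h
  exact ⟨∑ j, A j, Finset.sum_nonneg fun j _ => hA₀ j, fun j =>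
    (hA j).mono_bound (Finset.single_le_sum (fun j _ => hA₀ j) (Finset.mem_univ j))⟩

theorem exists_succ [Finite ι] {B : ℝ} {f' : V → V →L[ℝ] ℝ} (hB : 0 ≤ B)
    (hfB : ∀ x ∈ S, |f x| ≤ B) (hf' : ∀ x ∈ S, HasFDerivWithinAt f (f' x) S x)
    (h : ∀ i, ∃ A, 0 ≤ A ∧ BoundedDerivs dir S A m (fun x => f' x (dir i))) :
    ∃ A, 0 ≤ A ∧ BoundedDerivs dir S A (m + 1) f := by
  obtain ⟨A, hA, hi⟩ := exists_uniform_bound h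
  exact ⟨A + B, by positivity, fun x hx => (hfB x hx).trans (by linarith), f', hf',
    fun i => (hi i).mono_bound (by linarith)⟩

theorem exists_of_hasCompactSupport_comp [Finite ι] {W : Type*} [NormedAddCommGroup W]
    [NormedSpace ℝ W] (L : V →L[ℝ] W) {ψ : W → ℝ} (hψ : ContDiff ℝ ∞ ψ)
    (hc : HasCompactSupport ψ) (m : ℕ) :
    ∃ A, 0 ≤ A ∧ BoundedDerivs dir univ A m (fun x => ψ (L x)) := by
  induction m generalizing ψ with
  | zero =>
    obtain ⟨B, hB⟩ := hc.exists_bound_of_continuous hψ.continuous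
    exact ⟨B, (norm_nonneg _).trans (hB 0), (hψ.continuous.comp L.continuous).continuousOn,
      fun x _ => hB (L x)⟩
  | succ m ih =>
    obtain ⟨B, hB⟩ := hc.exists_bound_of_continuous hψ.continuous
    refine exists_succ (f' := fun x => (fderiv ℝ ψ (L x)).comp L) ((norm_nonneg _).trans (hB 0))
      (fun x _ => hB (L x)) (fun x _ => ?_) fun i => ?_
    · have hψ' := (hψ.differentiable (by simp) (L x)).hasFDerivAt
      exact (hψ'.comp x L.hasFDerivAt).hasFDerivWithinAt
    · exact ih (ψ := fun y => fderiv ℝ ψ y (L (dir i)))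
        ((hψ.fderiv_right (m := ∞) (by simp)).clm_apply contDiff_const)
        (hc.fderiv_apply ℝ (L (dir i)))

end BoundedDerivs

end BoundedDerivs

/-! ### Weak derivatives and the Sobolev norm -/

section WeakDeriv

section Topology

variable {X : Type*} [TopologicalSpace X] [MeasurableSpace X] {μ : Measure X} {U : Set X}
  {u ζ : X → ℝ}

theorem setIntegral_mul_of_tsupport_subset (hζU : tsupport ζ ⊆ U) :
    ∫ x in U, u x * ζ x ∂μ = ∫ x, u x * ζ x ∂μ :=
  setIntegral_eq_integral_of_forall_compl_eq_zero fun x hx => by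
    rw [image_eq_zero_of_notMem_tsupport fun h => hx (hζU h), mul_zero]

theorem integrable_mul_of_locallyIntegrableOn [OpensMeasurableSpace X] [T2Space X]
    (hu : LocallyIntegrableOn u U μ) (hζ : Continuous ζ) (hζc : HasCompactSupport ζ)
    (hζU : tsupport ζ ⊆ U) : Integrable (fun x => u x * ζ x) μ := by
  have hint : IntegrableOn (fun x => u x * ζ x) (tsupport ζ) μ :=
    (hu.integrableOn_compact_subset hζU hζc.isCompact).mul_continuousOn hζ.continuousOn
      hζc.isCompact
  refine (integrableOn_iff_integrable_of_support_subset fun x hx => ?_).1 hint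
  exact subset_tsupport ζ (right_ne_zero_of_mul hx)

theorem forall_le_of_ae_restrict_le [OpensMeasurableSpace X] [μ.IsOpenPosMeasure] {M : ℝ}
    (hU : IsOpen U) (hu : ContinuousOn u U) (h : ∀ᵐ x ∂(μ.restrict U), u x ≤ M) :
    ∀ x ∈ U, u x ≤ M := by
  rw [ae_restrict_iff' hU.measurableSet, ae_iff] at h
  have hnull : μ (U ∩ u ⁻¹' Ioi M) = 0 := measure_mono_null (fun x hx => by simpa using hx) h
  have hempty := ((hu.isOpen_inter_preimage hU isOpen_Ioi).measure_eq_zero_iff μ).1 hnull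
  exact fun x hx => not_lt.1 fun hlt => eq_empty_iff_forall_notMem.1 hempty x ⟨hx, hlt⟩

end Topology

theorem forall_abs_le_of_subset_closure {X : Type*} [TopologicalSpace X] {S Q : Set X} {f : X → ℝ}
    {M : ℝ} (hQS : Q ⊆ S) (hSQ : S ⊆ closure Q) (hf : ContinuousOn f S) (h : ∀ x ∈ Q, |f x| ≤ M) :
    ∀ x ∈ S, |f x| ≤ M := fun x hx => by
  simpa using ((hf.abs x hx).mono hQS).mem_closure (hSQ hx) (t := Iic M) h

variable {V : Type*} [NormedAddCommGroup V] [NormedSpace ℝ V]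

theorem contDiff_iteratedFDeriv_apply {η : V → ℝ} (hη : ContDiff ℝ ∞ η) {n : ℕ} (w : Fin n → V) :
    ContDiff ℝ ∞ fun x => iteratedFDeriv ℝ n η x w :=
  (ContinuousMultilinearMap.apply ℝ (fun _ : Fin n => V) ℝ w).contDiff.comp
    (hη.iteratedFDeriv_right (by exact_mod_cast le_top))

theorem tsupport_iteratedFDeriv_apply_subset (η : V → ℝ) {n : ℕ} (w : Fin n → V) :
    tsupport (fun x => iteratedFDeriv ℝ n η x w) ⊆ tsupport η := by
  refine (closure_mono ?_).trans (tsupport_iteratedFDeriv_subset (𝕜 := ℝ) n)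
  refine fun x hx hx' => hx ?_
  simp only [hx', zero_apply]

theorem integral_mul_fderiv_of_tsupport_subset [MeasurableSpace V] [BorelSpace V]
    [FiniteDimensional ℝ V] {μ : Measure V} [μ.IsAddHaarMeasure] {U : Set V} {u ζ : V → ℝ}
    {u' : V → V →L[ℝ] ℝ} {v : V} (hU : IsOpen U)
    (hu' : ∀ x ∈ U, HasFDerivAt u (u' x) x) (hc : ContinuousOn (fun x => u' x v) U)
    (hζ : ContDiff ℝ ∞ ζ) (hζc : HasCompactSupport ζ) (hζU : tsupport ζ ⊆ U) :
    ∫ x, u x * fderiv ℝ ζ x v ∂μ = -∫ x, u' x v * ζ x ∂μ := by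
  have hu : LocallyIntegrableOn u U μ :=
    ContinuousOn.locallyIntegrableOn (fun x hx => (hu' x hx).continuousAt.continuousWithinAt)
      hU.measurableSet
  have hζ' : Continuous fun x => fderiv ℝ ζ x v :=
    (hζ.continuous_fderiv (by simp)).clm_apply continuous_const
  exact integral_bilinear_hasFDerivAt_right_eq_neg_left_of_integrable
    (B := ContinuousLinearMap.mul ℝ ℝ)
    (integrable_mul_of_locallyIntegrableOn (hc.locallyIntegrableOn hU.measurableSet)
      hζ.continuous hζc hζU)
    (integrable_mul_of_locallyIntegrableOn hu hζ' (hζc.fderiv_apply ℝ v)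
      ((tsupport_fderiv_apply_subset ℝ v).trans hζU))
    (integrable_mul_of_locallyIntegrableOn hu hζ.continuous hζc hζU)
    (fun x hx => hu' x (hζU hx))
    (fun x _ => (hζ.differentiable (by simp) x).hasFDerivAt)

end WeakDeriv

section Sobolev

variable {d : ℕ} {Q : Set (SpaceTime d)} {n k m : ℕ} {κ : Fin n → Fin (d + 1)}
  {u v : SpaceTime d → ℝ} {M : ℝ}

instance isAddHaarMeasure_volume_spaceTime (d : ℕ) :
    (volume : Measure (SpaceTime d)).IsAddHaarMeasure :=
  Measure.prod.instIsAddHaarMeasure volume volume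

namespace IsWeakDeriv

theorem of_continuousOn (hQ : IsOpen Q) (hu : ContinuousOn u Q) (κ : Fin 0 → Fin (d + 1)) :
    IsWeakDeriv Q κ u u :=
  ⟨hu.locallyIntegrableOn hQ.measurableSet, hu.locallyIntegrableOn hQ.measurableSet,
    fun η _ _ _ => by simp⟩

theorem of_tail (hQ : IsOpen Q) {κ : Fin (n + 1) → Fin (d + 1)}
    {u' : SpaceTime d → SpaceTime d →L[ℝ] ℝ} (hu' : ∀ z ∈ Q, HasFDerivAt u (u' z) z)
    (hc : ContinuousOn (fun z => u' z (coordDir d (κ 0))) Q)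
    (hv : IsWeakDeriv Q (Fin.tail κ) (fun z => u' z (coordDir d (κ 0))) v) :
    IsWeakDeriv Q κ u v := by
  have hu : ContinuousOn u Q := fun z hz => (hu' z hz).continuousAt.continuousWithinAt
  refine ⟨hu.locallyIntegrableOn hQ.measurableSet, hv.2.1, fun η hη hηc hηQ => ?_⟩
  set e := coordDir d (κ 0)
  set ζ : SpaceTime d → ℝ := fun z =>
    iteratedFDeriv ℝ n η z fun i => coordDir d (Fin.tail κ i) with hζ
  have hζsub : tsupport ζ ⊆ tsupport η := tsupport_iteratedFDeriv_apply_subset η _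
  have hζQ : tsupport ζ ⊆ Q := hζsub.trans hηQ
  have hη_succ : ∀ z, iteratedFDeriv ℝ (n + 1) η z (fun i => coordDir d (κ i)) = fderiv ℝ ζ z e :=
    fun z => by
      rw [iteratedFDeriv_succ_apply_left, hζ, fderiv_continuousMultilinear_apply_const_apply
        (hη.differentiable_iteratedFDeriv (by exact_mod_cast ENat.natCast_lt_top n) z)]
      rfl
  calc ∫ z in Q, u z * iteratedFDeriv ℝ (n + 1) η z (fun i => coordDir d (κ i))
      = ∫ z, u z * fderiv ℝ ζ z e := by
        simp_rw [hη_succ]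
        exact setIntegral_mul_of_tsupport_subset ((tsupport_fderiv_apply_subset ℝ e).trans hζQ)
    _ = -∫ z, u' z e * ζ z := integral_mul_fderiv_of_tsupport_subset hQ hu' hc
        (contDiff_iteratedFDeriv_apply hη _) (hηc.mono' ((subset_tsupport ζ).trans hζsub)) hζQ
    _ = -∫ z in Q, u' z e * ζ z := by rw [setIntegral_mul_of_tsupport_subset hζQ]
    _ = (-1) ^ (n + 1) * ∫ z in Q, v z * η z := by
        rw [hv.2.2 η hη hηc hηQ, pow_succ]
        ring

theorem ae_eq (hQ : IsOpen Q) {w : SpaceTime d → ℝ} (hv : IsWeakDeriv Q κ u v)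
    (hw : IsWeakDeriv Q κ u w) : v =ᵐ[volume.restrict Q] w := by
  have hzero : ∀ᵐ z ∂(volume : Measure (SpaceTime d)), z ∈ Q → (v - w) z = 0 := by
    refine hQ.ae_eq_zero_of_integral_contDiff_smul_eq_zero (hv.2.1.sub hw.2.1)
      fun η hη hηc hηQ => ?_
    have hint := hv.2.2 η hη hηc hηQ
    rw [hw.2.2 η hη hηc hηQ, setIntegral_mul_of_tsupport_subset hηQ,
      setIntegral_mul_of_tsupport_subset hηQ] at hint
    calc ∫ z, η z • (v - w) z = ∫ z, (v z * η z - w z * η z) := by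
          simp only [smul_eq_mul, Pi.sub_apply, mul_sub, mul_comm]
      _ = (∫ z, v z * η z) - ∫ z, w z * η z :=
          integral_sub (integrable_mul_of_locallyIntegrableOn hv.2.1 hη.continuous hηc hηQ)
            (integrable_mul_of_locallyIntegrableOn hw.2.1 hη.continuous hηc hηQ)
      _ = 0 := by rw [mul_left_cancel₀ (pow_ne_zero n (by norm_num)) hint, sub_self]
  rw [Filter.EventuallyEq, ae_restrict_iff' hQ.measurableSet]
  filter_upwards [hzero] with z hz hzQ
  exact sub_eq_zero.1 (hz hzQ)

theorem abs_le_of_sobolevNorm_le (hQ : IsOpen Q) (hn : n ≤ k) (hv : IsWeakDeriv Q κ u v)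
    (hc : ContinuousOn v Q) (hM : 0 ≤ M) (hu : sobolevNorm k Q u ≤ ENNReal.ofReal M) :
    ∀ z ∈ Q, |v z| ≤ M := by
  have hnorm : eLpNormEssSup v (volume.restrict Q) ≤ ENNReal.ofReal M := by
    rw [← eLpNorm_exponent_top]
    refine le_trans ?_ ((le_iSup₂_of_le n hn (le_iSup_of_le κ le_rfl)).trans hu)
    exact le_iInf₂ fun w hw => (eLpNorm_congr_ae (hv.ae_eq hQ hw)).le
  refine forall_le_of_ae_restrict_le (μ := volume) hQ hc.abs ?_
  filter_upwards [ae_le_eLpNormEssSup (f := v) (μ := volume.restrict Q)] with z hz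
  have := hz.trans hnorm
  rwa [← ofReal_norm, ENNReal.ofReal_le_ofReal_iff hM] at this

end IsWeakDeriv

theorem BoundedDerivs.exists_isWeakDeriv (hQ : IsOpen Q) (hu : BoundedDerivs (coordDir d) Q M k u)
    (hn : n ≤ k) (κ : Fin n → Fin (d + 1)) : ∃ v, IsWeakDeriv Q κ u v ∧ ∀ z ∈ Q, |v z| ≤ M := by
  induction n generalizing k u with
  | zero => exact ⟨u, .of_continuousOn hQ hu.continuousOn κ, hu.abs_le⟩
  | succ n ih =>
    obtain ⟨k, rfl⟩ : ∃ j, k = j + 1 := ⟨k - 1, by omega⟩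
    obtain ⟨_, u', hu', hi⟩ := hu
    obtain ⟨v, hv, hb⟩ := ih (hi (κ 0)) (by omega) (Fin.tail κ)
    exact ⟨v, .of_tail hQ (fun z hz => (hu' z hz).hasFDerivAt (hQ.mem_nhds hz))
      (hi (κ 0)).continuousOn hv, hb⟩

theorem BoundedDerivs.sobolevNorm_le (hQ : IsOpen Q) (hu : BoundedDerivs (coordDir d) Q M k u) :
    sobolevNorm k Q u ≤ ENNReal.ofReal M := by
  refine iSup_le fun n => iSup_le fun hn => iSup_le fun κ => ?_
  obtain ⟨v, hv, hb⟩ := hu.exists_isWeakDeriv hQ hn κ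
  have hvM : ∀ᵐ z ∂(volume.restrict Q), ‖v z‖ ≤ M :=
    (ae_restrict_iff' hQ.measurableSet).2 (.of_forall hb)
  refine (iInf₂_le v hv).trans ?_
  simpa using eLpNorm_le_of_ae_bound (p := ∞) hvM

theorem sobolevNorm_mono (h : k ≤ m) (u : SpaceTime d → ℝ) :
    sobolevNorm k Q u ≤ sobolevNorm m Q u :=
  iSup_le fun n => iSup_le fun hn => le_iSup₂_of_le n (hn.trans h) le_rfl

theorem boundedDerivs_of_forall_isWeakDeriv {S : Set (SpaceTime d)} {f : SpaceTime d → ℝ}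
    (hQ : IsOpen Q) (hQS : Q ⊆ S) (hSQ : S ⊆ closure Q) (hS : UniqueDiffOn ℝ S)
    (hf : ContDiffOn ℝ m f S)
    (hb : ∀ n ≤ m, ∀ (κ : Fin n → Fin (d + 1)) (v : SpaceTime d → ℝ), ContinuousOn v Q →
      IsWeakDeriv Q κ f v → ∀ z ∈ Q, |v z| ≤ M) :
    BoundedDerivs (coordDir d) S M m f := by
  have hfQ : ContinuousOn f Q := hf.continuousOn.mono hQS
  have hfM : ∀ z ∈ S, |f z| ≤ M := forall_abs_le_of_subset_closure hQS hSQ hf.continuousOn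
    (hb 0 (Nat.zero_le m) Fin.elim0 f hfQ (.of_continuousOn hQ hfQ _))
  induction m generalizing f with
  | zero => exact ⟨hf.continuousOn, hfM⟩
  | succ m ih =>
    have hf' : ∀ z ∈ S, HasFDerivWithinAt f (fderivWithin ℝ f S z) S z := fun z hz =>
      (hf.differentiableOn (by simp) z hz).hasFDerivWithinAt
    refine ⟨hfM, fderivWithin ℝ f S, hf', fun i => ?_⟩
    have hfi : ContDiffOn ℝ m (fun z => fderivWithin ℝ f S z (coordDir d i)) S :=
      (hf.fderivWithin hS (by simp)).clm_apply contDiffOn_const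
    have hfiQ := hfi.continuousOn.mono hQS
    have hbi : ∀ n ≤ m, ∀ (κ : Fin n → Fin (d + 1)) (v : SpaceTime d → ℝ), ContinuousOn v Q →
        IsWeakDeriv Q κ (fun z => fderivWithin ℝ f S z (coordDir d i)) v →
        ∀ z ∈ Q, |v z| ≤ M := fun n hn κ v hv hw =>
      hb (n + 1) (by omega) (Fin.cons i κ) v hv (.of_tail hQ
        (fun z hz => (hf' z (hQS hz)).hasFDerivAt (Filter.mem_of_superset (hQ.mem_nhds hz) hQS))
        hfiQ hw)
    exact ih hfi hbi hfiQ (forall_abs_le_of_subset_closure hQS hSQ hfi.continuousOn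
      (hbi 0 (Nat.zero_le m) Fin.elim0 _ hfiQ (.of_continuousOn hQ hfiQ _)))

theorem boundedDerivs_of_sobolevNorm_le {S : Set (SpaceTime d)} {f : SpaceTime d → ℝ}
    (hQ : IsOpen Q) (hQS : Q ⊆ S) (hSQ : S ⊆ closure Q) (hS : UniqueDiffOn ℝ S) (hM : 0 ≤ M)
    (hf : ContDiffOn ℝ m f S) (hn : sobolevNorm m Q f ≤ ENNReal.ofReal M) :
    BoundedDerivs (coordDir d) S M m f :=
  boundedDerivs_of_forall_isWeakDeriv hQ hQS hSQ hS hf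
    fun _ hnm _ _ hv hw => hw.abs_le_of_sobolevNorm_le hQ hnm hv hM hn

end Sobolev

/-! ### Extension by weighted reflections -/

theorem exists_interpolation_coeffs {m : ℕ} {x : Fin (m + 1) → ℝ} (hx : Function.Injective x)
    (a : ℕ) : ∃ c : Fin (m + 1) → ℝ, ∀ j ≤ m, ∑ b, c b * x b ^ j = if j = a then 1 else 0 := by
  refine ⟨fun b => (Lagrange.basis Finset.univ x b).coeff a, fun j hj => ?_⟩
  have hdeg : (Polynomial.X ^ j : Polynomial ℝ).degree <
      (Finset.univ : Finset (Fin (m + 1))).card := by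
    rw [Polynomial.degree_X_pow, Finset.card_univ, Fintype.card_fin]
    exact_mod_cast Nat.lt_succ_of_le hj
  have hcoeff := congrArg (fun p : Polynomial ℝ => p.coeff a)
    (Lagrange.eq_interpolate hx.injOn hdeg)
  simp only [Lagrange.interpolate_apply, Polynomial.finsetSum_coeff, Polynomial.coeff_C_mul,
    Polynomial.coeff_X_pow, Polynomial.eval_pow, Polynomial.eval_X] at hcoeff
  simp only [eq_comm (a := j), hcoeff, mul_comm]

theorem hasFDerivWithinAt_of_inter_nonpos_of_inter_nonneg {V F : Type*} [NormedAddCommGroup V]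
    [NormedSpace ℝ V] [NormedAddCommGroup F] [NormedSpace ℝ F] {P : Set V} {ρ : V → ℝ} {g : V → F}
    {g' : V →L[ℝ] F} {x : V} (hρ : Continuous ρ)
    (hnonpos : ρ x ≤ 0 → HasFDerivWithinAt g g' (P ∩ {y | ρ y ≤ 0}) x)
    (hnonneg : 0 ≤ ρ x → HasFDerivWithinAt g g' (P ∩ {y | 0 ≤ ρ y}) x) :
    HasFDerivWithinAt g g' P x := by
  have hP : P = (P ∩ {y | ρ y ≤ 0}) ∪ (P ∩ {y | 0 ≤ ρ y}) := by
    rw [← inter_union_distrib_left]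
    exact (inter_eq_left.2 fun y _ => le_total (ρ y) 0).symm
  have of_isClosed : ∀ {C : Set V}, IsClosed C →
      (x ∈ C → HasFDerivWithinAt g g' (P ∩ C) x) → HasFDerivWithinAt g g' (P ∩ C) x :=
    fun {C} hC h => by
      by_cases hx : x ∈ C
      · exact h hx
      · exact HasFDerivWithinAt.of_notMem_closure fun hmem =>
          hx (closure_minimal inter_subset_right hC hmem)
  rw [hP]
  exact (of_isClosed (isClosed_le hρ continuous_const) hnonpos).union
    (of_isClosed (isClosed_le continuous_const hρ) hnonneg)

/-- The extension of `a • f` from `{ρ ≤ 0}` across `{ρ = 0}` by a weighted sum of values of `f` at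
points reflected in the direction `e`. -/
noncomputable def reflectExtend {V F J : Type*} [AddCommGroup V] [Module ℝ V] [AddCommGroup F]
    [Module ℝ F] [Fintype J] (ρ : V → ℝ) (e : V) (lam c : J → ℝ) (a : ℝ) (f : V → F) (x : V) : F :=
  if ρ x ≤ 0 then a • f x else ∑ j, c j • f (x - (lam j * ρ x) • e)

section Reflect

variable {V F : Type*} [NormedAddCommGroup V] [NormedSpace ℝ V] [NormedAddCommGroup F]
  [NormedSpace ℝ F] {ι J : Type*} [Fintype J] {S P : Set V} {ρ : V → ℝ} {e : V} {lam c : J → ℝ}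
  {a : ℝ}

theorem reflectExtend_of_nonneg {f : V → F} (hc : ∑ j, c j = a) {x : V} (hx : 0 ≤ ρ x) :
    reflectExtend ρ e lam c a f x = ∑ j, c j • f (x - (lam j * ρ x) • e) := by
  rw [reflectExtend]
  split_ifs with h
  · simp only [le_antisymm h hx, mul_zero, zero_smul, sub_zero, ← Finset.sum_smul, hc]
  · rfl

theorem continuousOn_reflectExtend {f : V → F} (hc : ∑ j, c j = a) (hρ : Continuous ρ)
    (hneg : ∀ x ∈ P, ρ x ≤ 0 → x ∈ S)
    (hpos : ∀ x ∈ P, 0 ≤ ρ x → ∀ j, x - (lam j * ρ x) • e ∈ S) (hf : ContinuousOn f S) :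
    ContinuousOn (reflectExtend ρ e lam c a f) P := by
  have hcl : closure {x | ¬ρ x ≤ 0} ⊆ {x | 0 ≤ ρ x} := by
    simpa only [not_le] using closure_lt_subset_le continuous_const hρ
  refine ContinuousOn.if (fun x hx => ?_) ?_ ?_
  · have hρx : ρ x = 0 := frontier_le_subset_eq hρ continuous_const hx.2
    simp only [hρx, mul_zero, zero_smul, sub_zero, ← Finset.sum_smul, hc]
  · rw [(isClosed_le hρ continuous_const).closure_eq]
    exact continuousOn_const.smul (hf.mono fun x hx => hneg x hx.1 hx.2)
  · refine continuousOn_finsetSum _ fun j _ => continuousOn_const.smul ?_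
    exact hf.comp (by fun_prop) fun x hx => hpos x hx.1 (hcl hx.2) j

theorem hasFDerivWithinAt_reflectExtend {ρ' : V → V →L[ℝ] ℝ} {f : V → F} {f' : V → V →L[ℝ] F}
    (hc : ∑ j, c j = a) (hclam : ∑ j, c j * lam j = 0) (hρ : ∀ x, HasFDerivAt ρ (ρ' x) x)
    (hneg : ∀ x ∈ P, ρ x ≤ 0 → x ∈ S)
    (hpos : ∀ x ∈ P, 0 ≤ ρ x → ∀ j, x - (lam j * ρ x) • e ∈ S)
    (hf : ∀ x ∈ S, HasFDerivWithinAt f (f' x) S x) {x : V} (hx : x ∈ P) :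
    HasFDerivWithinAt (reflectExtend ρ e lam c a f)
      (reflectExtend ρ e lam c a f' x -
        (ρ' x).smulRight (reflectExtend ρ e lam (fun j => c j * lam j) 0 (fun y => f' y e) x))
      P x := by
  have hρc : Continuous ρ := continuous_iff_continuousAt.2 fun x => (hρ x).continuousAt
  refine hasFDerivWithinAt_of_inter_nonpos_of_inter_nonneg hρc (fun h => ?_) fun h => ?_
  · have hafx : HasFDerivWithinAt (fun y => a • f y) (a • f' x) (P ∩ {x | ρ x ≤ 0}) x :=
      ((hf x (hneg x hx h)).mono fun y hy => hneg y hy.1 hy.2).const_smul a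
    refine (hafx.congr (fun y hy => if_pos hy.2) (if_pos h)).congr_fderiv ?_
    ext v
    simp [reflectExtend, h]
  · have hreflect : ∀ j, HasFDerivWithinAt (fun y => y - (lam j * ρ y) • e)
        (ContinuousLinearMap.id ℝ V - (lam j • ρ' x).smulRight e) (P ∩ {x | 0 ≤ ρ x}) x :=
      fun j => (hasFDerivWithinAt_id x _).sub
        (((hρ x).hasFDerivWithinAt.const_mul (lam j)).smul_const e)
    have hsum := HasFDerivWithinAt.fun_sum fun j (_ : j ∈ Finset.univ) =>
      (((hf _ (hpos x hx h j)).comp x (hreflect j) fun y hy => hpos y hy.1 hy.2 j).const_smul (c j))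
    refine (hsum.congr (fun y hy => reflectExtend_of_nonneg hc hy.2)
      (reflectExtend_of_nonneg hc h)).congr_fderiv ?_
    rw [reflectExtend_of_nonneg hc h, reflectExtend_of_nonneg hclam h]
    ext v
    simp [smul_sub, Finset.smul_sum, smul_smul, mul_comm, mul_left_comm, mul_assoc]

theorem abs_reflectExtend_le {M : ℝ} {f : V → ℝ} (hM : 0 ≤ M) (hneg : ∀ x ∈ P, ρ x ≤ 0 → x ∈ S)
    (hpos : ∀ x ∈ P, 0 ≤ ρ x → ∀ j, x - (lam j * ρ x) • e ∈ S) (hf : ∀ x ∈ S, |f x| ≤ M) :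
    ∀ x ∈ P, |reflectExtend ρ e lam c a f x| ≤ (|a| + ∑ j, |c j|) * M := by
  have abs_smul_le : ∀ (r : ℝ), ∀ x ∈ S, |r • f x| ≤ |r| * M := fun r x hx => by
    rw [smul_eq_mul, abs_mul]
    exact mul_le_mul_of_nonneg_left (hf x hx) (abs_nonneg r)
  intro x hx
  rw [reflectExtend, add_mul, Finset.sum_mul]
  split_ifs with h
  · exact le_add_of_le_of_nonneg (abs_smul_le a x (hneg x hx h)) (by positivity)
  · exact le_add_of_nonneg_of_le (by positivity) ((Finset.abs_sum_le_sum_abs _ _).trans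
      (Finset.sum_le_sum fun j _ => abs_smul_le (c j) _ (hpos x hx (not_le.1 h).le j)))

namespace BoundedDerivs

variable [Fintype ι] {dir : ι → V} {A : ℝ} {ρ' : V → V →L[ℝ] ℝ} {w : ι → ℝ}

theorem reflectExtend_succ {m : ℕ} {f : V → ℝ} {K₁ K₂ M : ℝ} (he : e = ∑ l, w l • dir l)
    (hρ : ∀ x, HasFDerivAt ρ (ρ' x) x) (hneg : ∀ x ∈ P, ρ x ≤ 0 → x ∈ S)
    (hpos : ∀ x ∈ P, 0 ≤ ρ x → ∀ j, x - (lam j * ρ x) • e ∈ S) (hA : 0 ≤ A)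
    (hρA : ∀ i, BoundedDerivs dir P A m (fun x => ρ' x (dir i))) (hc : ∑ j, c j = a)
    (hclam : ∑ j, c j * lam j = 0) (hM : 0 ≤ M) (hK₁ : 0 ≤ K₁) (hK₂ : 0 ≤ K₂)
    (h₁ : ∀ g, BoundedDerivs dir S M m g →
      BoundedDerivs dir P (K₁ * M) m (reflectExtend ρ e lam c a g))
    (h₂ : ∀ g, BoundedDerivs dir S M m g →
      BoundedDerivs dir P (K₂ * M) m (reflectExtend ρ e lam (fun j => c j * lam j) 0 g))
    (hf : BoundedDerivs dir S M (m + 1) f) :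
    BoundedDerivs dir P ((K₁ + 2 ^ m * (A * ∑ l, |w l| * K₂) + (|a| + ∑ j, |c j|)) * M) (m + 1)
      (reflectExtend ρ e lam c a f) := by
  obtain ⟨hfM, f', hf', hfi⟩ := hf
  refine ⟨fun x hx => (abs_reflectExtend_le hM hneg hpos hfM x hx).trans ?_, _,
    fun x hx => hasFDerivWithinAt_reflectExtend hc hclam hρ hneg hpos hf' hx, fun i => ?_⟩
  · exact mul_le_mul_of_nonneg_right (le_add_of_nonneg_left (by positivity)) hM
  · have he' : BoundedDerivs dir P (∑ l, |w l| * (K₂ * M)) m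
        (reflectExtend ρ e lam (fun j => c j * lam j) 0 fun x => f' x e) := by
      refine (BoundedDerivs.sum Finset.univ fun l _ => (h₂ _ (hfi l)).const_mul (w l)).congr
        fun x _ => ?_
      simp only [reflectExtend, he, map_sum, map_smul, smul_eq_mul, zero_mul, Finset.mul_sum]
      split_ifs
      · simp
      · rw [Finset.sum_comm]
        simp only [Finset.mul_sum, mul_left_comm (w _)]
    have hρ'mul := BoundedDerivs.mul hA (by positivity) (hρA i) he'
    refine (((h₁ _ (hfi i)).sub hρ'mul).mono_bound ?_).congr fun x _ => ?_
    · have hsum : ∑ l, |w l| * (K₂ * M) = (∑ l, |w l| * K₂) * M := by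
        simp only [Finset.sum_mul, mul_assoc]
      rw [hsum]
      have : 0 ≤ (|a| + ∑ j, |c j|) * M := by positivity
      linarith
    · simp only [reflectExtend]
      split_ifs <;> simp

theorem exists_reflectExtend (he : e = ∑ l, w l • dir l) (hρ : ∀ x, HasFDerivAt ρ (ρ' x) x)
    (hneg : ∀ x ∈ P, ρ x ≤ 0 → x ∈ S) (hpos : ∀ x ∈ P, 0 ≤ ρ x → ∀ j, x - (lam j * ρ x) • e ∈ S)
    (hA : 0 ≤ A) (m : ℕ) (hρA : ∀ i, BoundedDerivs dir P A m (fun x => ρ' x (dir i)))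
    (hc : ∀ i ≤ m, ∑ j, c j * lam j ^ i = if i = 0 then a else 0) :
    ∃ K, 0 ≤ K ∧ ∀ (f : V → ℝ) (M : ℝ), 0 ≤ M → BoundedDerivs dir S M m f →
      BoundedDerivs dir P (K * M) m (reflectExtend ρ e lam c a f) := by
  induction m generalizing c a with
  | zero =>
    have hρc : Continuous ρ := continuous_iff_continuousAt.2 fun x => (hρ x).continuousAt
    exact ⟨_, by positivity, fun f M hM hf =>
      ⟨continuousOn_reflectExtend (by simpa using hc 0 le_rfl) hρc hneg hpos hf.1,
        abs_reflectExtend_le hM hneg hpos hf.2⟩⟩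
  | succ m ih =>
    have hρA' := fun i => (hρA i).of_succ
    have hclam : ∀ i ≤ m, ∑ j, c j * lam j * lam j ^ i = if i = 0 then 0 else 0 := fun i hi => by
      simpa [pow_succ', mul_assoc] using hc (i + 1) (by omega)
    obtain ⟨K₁, hK₁, h₁⟩ := ih hρA' fun i hi => hc i (by omega)
    obtain ⟨K₂, hK₂, h₂⟩ := ih hρA' hclam
    exact ⟨_, by positivity, fun f M hM hf => reflectExtend_succ he hρ hneg hpos hA hρA'
      (by simpa using hc 0 (Nat.zero_le _)) (by simpa using hc 1 (by omega)) hM hK₁ hK₂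
      (fun g => h₁ g M hM) (fun g => h₂ g M hM) hf⟩

end BoundedDerivs

theorem exists_extension_across [Fintype ι] {dir : ι → V} {ρ' : V → V →L[ℝ] ℝ} {w : ι → ℝ} {m : ℕ}
    (b : ℝ) (he : e = ∑ l, w l • dir l) (hρ : ∀ x, HasFDerivAt ρ (ρ' x) x)
    (hneg : ∀ x ∈ P, ρ x ≤ 0 → x ∈ S)
    (hpos : ∀ x ∈ P, 0 ≤ ρ x → ∀ s ∈ Icc b (b + m), x - (s * ρ x) • e ∈ S)
    (hρ' : ∀ i, ∃ A, 0 ≤ A ∧ BoundedDerivs dir P A m (fun x => ρ' x (dir i))) :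
    ∃ K, 0 ≤ K ∧ ∀ (f : V → ℝ) (M : ℝ), 0 ≤ M → BoundedDerivs dir S M m f →
      ∃ F : V → ℝ, EqOn F f (P ∩ {x | ρ x ≤ 0}) ∧ BoundedDerivs dir P (K * M) m F := by
  let lam : Fin (m + 1) → ℝ := fun j => b + (j : ℕ)
  have hlam_inj : Function.Injective lam := fun i j hij => Fin.ext (by simpa [lam] using hij)
  have hlam_mem : ∀ j, lam j ∈ Icc b (b + m) := fun j =>
    ⟨by simp [lam], add_le_add_right (Nat.cast_le.2 (Nat.lt_succ_iff.1 j.2)) b⟩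
  obtain ⟨c, hc⟩ := exists_interpolation_coeffs hlam_inj 0
  obtain ⟨A, hA, hρA⟩ := BoundedDerivs.exists_uniform_bound hρ'
  obtain ⟨K, hK, hKb⟩ := BoundedDerivs.exists_reflectExtend he hρ hneg
    (fun x hx hx0 j => hpos x hx hx0 _ (hlam_mem j)) hA m hρA hc
  refine ⟨K, hK, fun f M hM hf => ⟨_, fun x hx => ?_, hKb f M hM hf⟩⟩
  exact (if_pos hx.2).trans (one_smul ℝ (f x))

end Reflect

/-! ### Sets with smooth boundary -/

theorem exists_contDiff_partition {E : Type*} [NormedAddCommGroup E] [NormedSpace ℝ E]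
    [FiniteDimensional ℝ E] {κ : Type*} [Fintype κ] {s : Set E} (hs : IsClosed s) (U : κ → Set E)
    (hUo : ∀ i, IsOpen (U i)) (hUb : ∀ i, Bornology.IsBounded (U i)) (hU : s ⊆ ⋃ i, U i) :
    ∃ χ : κ → E → ℝ, (∀ i, ContDiff ℝ ∞ (χ i)) ∧ (∀ i, HasCompactSupport (χ i)) ∧
      (∀ i, tsupport (χ i) ⊆ U i) ∧ ∀ x ∈ s, ∑ i, χ i x = 1 := by
  obtain ⟨χ, hχ⟩ :=
    SmoothPartitionOfUnity.exists_isSubordinate (modelWithCornersSelf ℝ E) hs U hUo hU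
  refine ⟨fun i => χ i, fun i => (χ i).contMDiff.contDiff, fun i => ?_, hχ, fun x hx => ?_⟩
  · exact Metric.isCompact_of_isClosed_isBounded (isClosed_tsupport _) ((hUb i).subset (hχ i))
  · rw [← χ.sum_eq_one hx, finsum_eq_sum_of_fintype]

section SmoothBoundary

variable {E : Type*} [NormedAddCommGroup E] [NormedSpace ℝ E]

/-- The condition on the boundary in `IsSmoothBoundedDomain`, for subsets of a normed space. -/
def HasSmoothBoundary (Ω : Set E) : Prop :=
  ∀ x ∈ frontier Ω, ∃ U : Set E, IsOpen U ∧ x ∈ U ∧ ∃ ρ : E → ℝ, ContDiffOn ℝ ∞ ρ U ∧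
    fderiv ℝ ρ x ≠ 0 ∧ Ω ∩ U = {y ∈ U | ρ y < 0}

/-- A compactly supported smooth function `ρ` that defines `Ω` within the ball of radius `r` about
`x₀` and grows there in the direction `e`. The speed `1 / 2` leaves room for the speed at `x₀` to
be normalized to `1`. -/
structure IsDefiningFunctionOnBall (Ω : Set E) (x₀ : E) (r : ℝ) (ρ : E → ℝ) (e : E) : Prop where
  contDiff : ContDiff ℝ ∞ ρ
  hasCompactSupport : HasCompactSupport ρ
  half_le_fderiv : ∀ x ∈ Metric.ball x₀ r, 1 / 2 ≤ fderiv ℝ ρ x e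
  mem_iff : ∀ x ∈ Metric.ball x₀ r, x ∈ Ω ↔ ρ x < 0

theorem exists_contDiff_hasCompactSupport_eventuallyEq [FiniteDimensional ℝ E] {U : Set E} {x₀ : E}
    {ρ : E → ℝ} (hU : U ∈ 𝓝 x₀) (hρ : ContDiffOn ℝ ∞ ρ U) :
    ∃ ψ : E → ℝ, ContDiff ℝ ∞ ψ ∧ HasCompactSupport ψ ∧ ψ =ᶠ[𝓝 x₀] ρ := by
  obtain ⟨r, hr, hrU⟩ := Metric.nhds_basis_closedBall.mem_iff.1 (interior_mem_nhds.2 hU)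
  let b : ContDiffBump x₀ := ⟨r / 2, r, half_pos hr, half_lt_self hr⟩
  refine ⟨fun x => b x * ρ x, ?_, b.hasCompactSupport.mul_right, ?_⟩
  · refine contMDiff_iff_contDiff.1 (contMDiff_of_tsupport fun x hx => ?_)
    have hxU := hrU (b.tsupport_eq ▸ tsupport_mul_subset_left hx)
    exact (b.contDiffAt.mul (hρ.contDiffAt (mem_interior_iff_mem_nhds.1 hxU))).contMDiffAt
  · filter_upwards [b.eventuallyEq_one] with x hx
    rw [hx, Pi.one_apply, one_mul]

variable {Ω : Set E} {x₀ e : E} {r : ℝ} {ρ : E → ℝ}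

theorem HasSmoothBoundary.exists_isDefiningFunctionOnBall [FiniteDimensional ℝ E]
    (hΩ : HasSmoothBoundary Ω) (hx₀ : x₀ ∈ frontier Ω) :
    ∃ r > 0, ∃ (ρ : E → ℝ) (e : E), IsDefiningFunctionOnBall Ω x₀ r ρ e := by
  obtain ⟨U, hU, hxU, ρ₀, hρ₀, hρ₀', hΩU⟩ := hΩ x₀ hx₀
  obtain ⟨v, hv⟩ := DFunLike.exists_ne hρ₀'
  obtain ⟨ρ, hρ, hρc, hρeq⟩ :=
    exists_contDiff_hasCompactSupport_eventuallyEq (hU.mem_nhds hxU) hρ₀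
  have hdef : ∀ᶠ x in 𝓝 x₀, x ∈ Ω ↔ ρ x < 0 := by
    filter_upwards [hU.mem_nhds hxU, hρeq] with x hx hρx
    simpa [hx, hρx] using Set.ext_iff.1 hΩU x
  have hspeed : ∀ᶠ x in 𝓝 x₀, 1 / 2 < fderiv ℝ ρ x ((fderiv ℝ ρ₀ x₀ v)⁻¹ • v) := by
    refine ((hρ.continuous_fderiv (by simp)).clm_apply
      continuous_const).continuousAt.eventually_const_lt ?_
    beta_reduce
    rw [hρeq.fderiv_eq, map_smul, smul_eq_mul, inv_mul_cancel₀ hv]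
    norm_num
  obtain ⟨r, hr, h⟩ := Metric.eventually_nhds_iff_ball.1 (hdef.and hspeed)
  exact ⟨r, hr, ρ, _, hρ, hρc, fun x hx => (h x hx).2.le, fun x hx => (h x hx).1⟩

namespace IsDefiningFunctionOnBall

variable {x : E}

theorem apply_sub_smul_le (h : IsDefiningFunctionOnBall Ω x₀ r ρ e) (hx : x ∈ Metric.ball x₀ r)
    {s : ℝ} (hs : 0 ≤ s) (hxs : x - s • e ∈ Metric.ball x₀ r) : ρ (x - s • e) ≤ ρ x - s / 2 := by
  have hρ := h.contDiff.differentiable (by simp)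
  obtain ⟨z, hz, hmvt⟩ := domain_mvt
    (fun y _ => (hρ y).hasFDerivAt.hasFDerivWithinAt) (convex_ball x₀ r) hx hxs
  have hspeed := h.half_le_fderiv z ((convex_ball x₀ r).segment_subset hx hxs hz)
  rw [sub_sub_cancel_left, map_neg, map_smul, smul_eq_mul] at hmvt
  nlinarith

theorem nonpos_of_mem_closure (h : IsDefiningFunctionOnBall Ω x₀ r ρ e)
    (hx : x ∈ Metric.ball x₀ r) (hxΩ : x ∈ closure Ω) : ρ x ≤ 0 :=
  closure_minimal (t := {x | ρ x ≤ 0}) (fun y hy => ((h.mem_iff y hy.1).1 hy.2).le)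
    (isClosed_le h.contDiff.continuous continuous_const)
    (Metric.isOpen_ball.inter_closure ⟨hx, hxΩ⟩)

theorem eq_zero_of_mem_frontier (h : IsDefiningFunctionOnBall Ω x₀ r ρ e) (hΩ : IsOpen Ω)
    (hx : x ∈ Metric.ball x₀ r) (hxΩ : x ∈ frontier Ω) : ρ x = 0 := by
  rw [hΩ.frontier_eq] at hxΩ
  exact le_antisymm (h.nonpos_of_mem_closure hx hxΩ.1)
    (not_lt.1 fun hneg => hxΩ.2 ((h.mem_iff x hx).2 hneg))

theorem mem_closure_of_nonpos (h : IsDefiningFunctionOnBall Ω x₀ r ρ e)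
    (hx : x ∈ Metric.ball x₀ r) (hρx : ρ x ≤ 0) : x ∈ closure Ω := by
  have hcont : Continuous fun t : ℝ => x - t • e := by fun_prop
  have htend : Filter.Tendsto (fun t : ℝ => x - t • e) (𝓝[>] 0) (𝓝 x) := by
    simpa using (hcont.tendsto 0).mono_left nhdsWithin_le_nhds
  refine mem_closure_of_tendsto htend ?_
  filter_upwards [htend.eventually (Metric.isOpen_ball.mem_nhds hx), self_mem_nhdsWithin]
    with t htball (htpos : 0 < t)
  exact (h.mem_iff _ htball).2 (by linarith [h.apply_sub_smul_le hx htpos.le htball])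

theorem sub_smul_mem_closure (h : IsDefiningFunctionOnBall Ω x₀ r ρ e)
    (hx : x ∈ Metric.ball x₀ r) (hρx : 0 ≤ ρ x) {s : ℝ} (hs : 2 ≤ s)
    (hxs : x - (s * ρ x) • e ∈ Metric.ball x₀ r) : x - (s * ρ x) • e ∈ closure Ω := by
  refine h.mem_closure_of_nonpos hxs ?_
  have := h.apply_sub_smul_le hx (by positivity) hxs
  nlinarith

theorem eventually_sub_smul_mem_ball (h : IsDefiningFunctionOnBall Ω x₀ r ρ e) (hr : 0 < r)
    (hx₀ : ρ x₀ = 0) (b : ℝ) :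
    ∀ᶠ x in 𝓝 x₀, ∀ s ∈ Icc 0 b, x - (s * ρ x) • e ∈ Metric.ball x₀ r := by
  have hρ := h.contDiff.continuous
  refine isCompact_Icc.eventually_forall_of_forall_eventually fun s _ => ?_
  have hcont : Continuous fun p : E × ℝ => p.1 - (p.2 * ρ p.1) • e := by fun_prop
  exact hcont.continuousAt.eventually (Metric.isOpen_ball.mem_nhds (by simpa [hx₀] using hr))

theorem mem_tangentConeAt (h : IsDefiningFunctionOnBall Ω x₀ r ρ e) (hr : 0 < r) (hx₀ : ρ x₀ = 0)
    {v : E} (hv : fderiv ℝ ρ x₀ v < 0) : v ∈ tangentConeAt ℝ Ω x₀ := by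
  have hline : HasDerivAt (fun t : ℝ => x₀ + t • v) v 0 := by
    simpa using ((hasDerivAt_id (0 : ℝ)).smul_const v).const_add x₀
  have hderiv : HasDerivAt (fun t : ℝ => ρ (x₀ + t • v)) (fderiv ℝ ρ x₀ v) 0 :=
    HasFDerivAt.comp_hasDerivAt_of_eq (x := (0 : ℝ))
      (h.contDiff.differentiable (by simp) x₀).hasFDerivAt hline (by simp)
  have hsign := (eventually_nhdsWithin_sign_eq_of_deriv_neg (hderiv.deriv.trans_lt hv)
    (by simpa using hx₀)).filter_mono (nhdsWithin_le_nhds (s := Ioi 0))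
  have hball : ∀ᶠ t : ℝ in 𝓝[>] 0, x₀ + t • v ∈ Metric.ball x₀ r :=
    (hline.continuousAt.eventually (Metric.isOpen_ball.mem_nhds (by simpa using hr))).filter_mono
      nhdsWithin_le_nhds
  refine mem_tangentConeAt_of_add_smul_mem (l := 𝓝[>] 0) (c := id)
    (nhdsWithin_mono 0 fun t ht => ne_of_gt ht) ?_
  filter_upwards [hsign, hball, self_mem_nhdsWithin] with t ht htball (htpos : 0 < t)
  rw [zero_sub, sign_neg (neg_neg_of_pos htpos), sign_eq_neg_one_iff] at ht
  exact (h.mem_iff _ htball).2 ht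

theorem uniqueDiffWithinAt (h : IsDefiningFunctionOnBall Ω x₀ r ρ e) (hr : 0 < r)
    (hx₀ : ρ x₀ = 0) : UniqueDiffWithinAt ℝ Ω x₀ := by
  have hx₀r : x₀ ∈ Metric.ball x₀ r := Metric.mem_ball_self hr
  refine ⟨?_, h.mem_closure_of_nonpos hx₀r hx₀.le⟩
  have hopen : IsOpen {v | fderiv ℝ ρ x₀ v < 0} :=
    isOpen_lt (fderiv ℝ ρ x₀).continuous continuous_const
  have hmem : -e ∈ {v | fderiv ℝ ρ x₀ v < 0} := by
    have := h.half_le_fderiv x₀ hx₀r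
    rw [mem_ofPred_eq, map_neg]
    linarith
  rw [Submodule.eq_top_of_nonempty_interior' (Submodule.span ℝ (tangentConeAt ℝ Ω x₀))
    ⟨-e, interior_maximal (fun v hv => Submodule.subset_span (h.mem_tangentConeAt hr hx₀ hv))
      hopen hmem⟩]
  exact dense_univ

end IsDefiningFunctionOnBall

theorem HasSmoothBoundary.uniqueDiffOn_closure [FiniteDimensional ℝ E] (hΩ : HasSmoothBoundary Ω)
    (hΩo : IsOpen Ω) : UniqueDiffOn ℝ (closure Ω) := by
  intro x hx
  by_cases hxΩ : x ∈ Ω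
  · exact (hΩo.uniqueDiffWithinAt hxΩ).mono subset_closure
  · have hfr : x ∈ frontier Ω := hΩo.frontier_eq ▸ ⟨hx, hxΩ⟩
    obtain ⟨r, hr, ρ, e, h⟩ := hΩ.exists_isDefiningFunctionOnBall hfr
    have hρx : ρ x = 0 := h.eq_zero_of_mem_frontier hΩo (Metric.mem_ball_self hr) hfr
    exact (h.uniqueDiffWithinAt hr hρx).mono subset_closure

end SmoothBoundary

/-! ### Extension from the space-time cylinder -/

/-- The coordinate functionals of space-time, dual to `coordDir`. -/
noncomputable def coordFun (d : ℕ) : Fin (d + 1) → SpaceTime d →L[ℝ] ℝ :=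
  Fin.cons (ContinuousLinearMap.fst ℝ ℝ (EuclideanSpace ℝ (Fin d)))
    (fun i => (EuclideanSpace.proj i).comp (ContinuousLinearMap.snd ℝ ℝ (EuclideanSpace ℝ (Fin d))))

theorem sum_coordFun_smul_coordDir {d : ℕ} (z : SpaceTime d) :
    ∑ i, coordFun d i z • coordDir d i = z := by
  rw [Fin.sum_univ_succ]
  simp only [coordFun, coordDir, Fin.cons_zero, Fin.cons_succ]
  refine Prod.ext ?_ ?_
  · simp [Prod.fst_sum]
  · ext j
    simp [Prod.snd_sum, Finset.sum_apply, Pi.single_apply]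

section Extension

variable {d : ℕ} {Ω : Set (EuclideanSpace ℝ (Fin d))} {x₀ : EuclideanSpace ℝ (Fin d)}

theorem IsDefiningFunctionOnBall.exists_local_extension {r : ℝ} {ρ : EuclideanSpace ℝ (Fin d) → ℝ}
    {e : EuclideanSpace ℝ (Fin d)} (h : IsDefiningFunctionOnBall Ω x₀ r ρ e) (hr : 0 < r)
    (hx₀ : ρ x₀ = 0) (m : ℕ) (I : Set ℝ) :
    ∃ δ > 0, ∃ K, 0 ≤ K ∧ ∀ (f : SpaceTime d → ℝ) (M : ℝ), 0 ≤ M →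
      BoundedDerivs (coordDir d) (I ×ˢ closure Ω) M m f →
      ∃ F : SpaceTime d → ℝ, EqOn F f (I ×ˢ (closure Ω ∩ Metric.ball x₀ δ)) ∧
        BoundedDerivs (coordDir d) (I ×ˢ Metric.ball x₀ δ) (K * M) m F := by
  obtain ⟨δ, hδ, hball⟩ := Metric.eventually_nhds_iff_ball.1
    (h.eventually_sub_smul_mem_ball hr hx₀ (2 + m))
  have hsub : ∀ x ∈ Metric.ball x₀ δ, x ∈ Metric.ball x₀ r := fun x hx => by
    simpa using hball x hx 0 (left_mem_Icc.2 (by positivity))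
  obtain ⟨K, hK, hext⟩ := exists_extension_across (dir := coordDir d) (S := I ×ˢ closure Ω)
    (P := I ×ˢ Metric.ball x₀ δ) (ρ := fun z => ρ z.2) (e := ((0 : ℝ), e)) (m := m)
    (ρ' := fun z => (fderiv ℝ ρ z.2).comp (ContinuousLinearMap.snd ℝ ℝ _)) 2
    (sum_coordFun_smul_coordDir _).symm
    (fun z => (h.contDiff.differentiable (by simp) z.2).hasFDerivAt.comp z hasFDerivAt_snd)
    (fun z hz hz0 => ⟨hz.1, h.mem_closure_of_nonpos (hsub z.2 hz.2) hz0⟩)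
    (fun z hz hz0 s hs => ⟨by simpa using hz.1, h.sub_smul_mem_closure (hsub z.2 hz.2) hz0 hs.1
      (hball z.2 hz.2 s ⟨zero_le_two.trans hs.1, hs.2⟩)⟩)
    (fun i => (BoundedDerivs.exists_of_hasCompactSupport_comp (ContinuousLinearMap.snd ℝ ℝ _)
      (ψ := fun y => fderiv ℝ ρ y (coordDir d i).2)
      ((h.contDiff.fderiv_right (m := ∞) (by simp)).clm_apply contDiff_const)
      (h.hasCompactSupport.fderiv_apply ℝ _) m).imp
        fun A hA => ⟨hA.1, hA.2.mono_set (subset_univ _)⟩)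
  refine ⟨δ, hδ, K, hK, fun f M hM hf => (hext f M hM hf).imp fun F hF => ⟨fun z hz => ?_, hF.2⟩⟩
  exact hF.1 ⟨⟨hz.1, hz.2.2⟩, h.nonpos_of_mem_closure (hsub z.2 hz.2.2) hz.2.1⟩

theorem HasSmoothBoundary.exists_local_extension (hΩ : HasSmoothBoundary Ω) (hΩo : IsOpen Ω)
    (m : ℕ) (I : Set ℝ) (hx₀ : x₀ ∈ closure Ω) :
    ∃ δ > 0, ∃ K, 0 ≤ K ∧ ∀ (f : SpaceTime d → ℝ) (M : ℝ), 0 ≤ M →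
      BoundedDerivs (coordDir d) (I ×ˢ closure Ω) M m f →
      ∃ F : SpaceTime d → ℝ, EqOn F f (I ×ˢ (closure Ω ∩ Metric.ball x₀ δ)) ∧
        BoundedDerivs (coordDir d) (I ×ˢ Metric.ball x₀ δ) (K * M) m F := by
  by_cases hx₀Ω : x₀ ∈ Ω
  · obtain ⟨δ, hδ, hball⟩ := Metric.isOpen_iff.1 hΩo x₀ hx₀Ω
    refine ⟨δ, hδ, 1, zero_le_one, fun f M _ hf => ⟨f, fun _ _ => rfl, ?_⟩⟩
    rw [one_mul]
    exact hf.mono_set (prod_mono_right (hball.trans subset_closure))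
  · have hfr : x₀ ∈ frontier Ω := hΩo.frontier_eq ▸ ⟨hx₀, hx₀Ω⟩
    obtain ⟨r, hr, ρ, e, h⟩ := hΩ.exists_isDefiningFunctionOnBall hfr
    exact h.exists_local_extension hr (h.eq_zero_of_mem_frontier hΩo (Metric.mem_ball_self hr) hfr)
      m I

theorem HasSmoothBoundary.exists_space_extension (hΩ : HasSmoothBoundary Ω) (hΩo : IsOpen Ω)
    (hΩb : Bornology.IsBounded Ω) (m : ℕ) (I : Set ℝ) :
    ∃ K, 0 ≤ K ∧ ∀ (f : SpaceTime d → ℝ) (M : ℝ), 0 ≤ M →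
      BoundedDerivs (coordDir d) (I ×ˢ closure Ω) M m f →
      ∃ F : SpaceTime d → ℝ, EqOn F f (I ×ˢ closure Ω) ∧
        BoundedDerivs (coordDir d) (I ×ˢ univ) (K * M) m F := by
  choose δ hδ K hK hext using fun x : closure Ω => hΩ.exists_local_extension hΩo m I x.2
  obtain ⟨t, ht⟩ := hΩb.isCompact_closure.elim_finite_subcover
    (fun x : closure Ω => Metric.ball (x : EuclideanSpace ℝ (Fin d)) (δ x))
    (fun x => Metric.isOpen_ball)
    fun x hx => mem_iUnion.2 ⟨⟨x, hx⟩, Metric.mem_ball_self (hδ ⟨x, hx⟩)⟩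
  obtain ⟨χ, hχ, hχc, hχU, hχ1⟩ := exists_contDiff_partition (κ := t) isClosed_closure
    (fun i => Metric.ball i.1.1 (δ i)) (fun i => Metric.isOpen_ball)
    (fun i => Metric.isBounded_ball) (ht.trans_eq (biUnion_eq_iUnion _ _))
  choose A hA hAb using fun i : t => BoundedDerivs.exists_of_hasCompactSupport_comp
    (dir := coordDir d) (ContinuousLinearMap.snd ℝ ℝ _) (hχ i) (hχc i) m
  refine ⟨∑ i : t, 2 ^ m * (A i * K i), Finset.sum_nonneg fun i _ =>
    mul_nonneg (by positivity) (mul_nonneg (hA i) (hK i)), fun f M hM hf => ?_⟩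
  choose F hFeq hF using fun i : t => hext i f M hM hf
  refine ⟨fun z => ∑ i, χ i z.2 * F i z, fun z hz => ?_, ?_⟩
  · have hterm : ∀ i, χ i z.2 * F i z = χ i z.2 * f z := fun i => by
      by_cases hzi : z.2 ∈ Metric.ball i.1.1 (δ i)
      · rw [hFeq i ⟨hz.1, hz.2, hzi⟩]
      · rw [image_eq_zero_of_notMem_tsupport fun h => hzi (hχU i h), zero_mul, zero_mul]
    simp only [hterm]
    rw [← Finset.sum_mul, hχ1 z.2 hz.2, one_mul]
  · rw [Finset.sum_mul]
    refine BoundedDerivs.sum Finset.univ fun i _ => ?_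
    have hset : (I ×ˢ (univ : Set (EuclideanSpace ℝ (Fin d)))) ∩
        Prod.snd ⁻¹' Metric.ball i.1.1 (δ i) = I ×ˢ Metric.ball i.1.1 (δ i) := by
      ext z; simp
    refine (BoundedDerivs.cutoff_mul (S := I ×ˢ univ) (mul_nonneg (hK i) hM) (hA i)
      (Metric.isOpen_ball.preimage continuous_snd)
      ((tsupport_comp_subset_preimage (χ i) continuous_snd).trans (preimage_mono (hχU i)))
      (hAb i) (by rw [hset]; exact hF i)).mono_bound (le_of_eq (by ring))

theorem exists_extension_across_time (d m : ℕ) (a t : ℝ) {I J : Set ℝ}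
    (hneg : ∀ u ∈ J, a * u ≤ t → u ∈ I)
    (hpos : ∀ u ∈ J, t ≤ a * u → ∀ s ∈ Icc (1 : ℝ) (1 + m), u - s * (a * u - t) * a ∈ I) :
    ∃ K, 0 ≤ K ∧ ∀ (f : SpaceTime d → ℝ) (M : ℝ), 0 ≤ M →
      BoundedDerivs (coordDir d) (I ×ˢ univ) M m f →
      ∃ F : SpaceTime d → ℝ, EqOn F f ({u ∈ J | a * u ≤ t} ×ˢ univ) ∧
        BoundedDerivs (coordDir d) (J ×ˢ univ) (K * M) m F := by
  let L := a • ContinuousLinearMap.fst ℝ ℝ (EuclideanSpace ℝ (Fin d))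
  obtain ⟨K, hK, hext⟩ := exists_extension_across (dir := coordDir d) (S := I ×ˢ univ)
    (P := J ×ˢ univ) (ρ := fun z => L z - t) (ρ' := fun _ => L) (e := (a, 0)) (m := m) 1
    (sum_coordFun_smul_coordDir _).symm (fun z => L.hasFDerivAt.sub_const t)
    (fun z hz hz0 => ⟨hneg z.1 hz.1 (sub_nonpos.1 hz0), trivial⟩)
    (fun z hz hz0 s hs => ⟨hpos z.1 hz.1 (sub_nonneg.1 hz0) s hs, trivial⟩)
    (fun i => ⟨_, abs_nonneg _, BoundedDerivs.const (L (coordDir d i)) le_rfl⟩)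
  refine ⟨K, hK, fun f M hM hf => (hext f M hM hf).imp fun F hF => ⟨fun z hz => ?_, hF.2⟩⟩
  exact hF.1 ⟨⟨hz.1.1, trivial⟩, sub_nonpos.2 hz.1.2⟩

theorem exists_time_extension (d m : ℕ) {T : ℝ} (hT : 0 < T) :
    ∃ K, 0 ≤ K ∧ ∃ η, 0 < η ∧ ∀ (f : SpaceTime d → ℝ) (M : ℝ), 0 ≤ M →
      BoundedDerivs (coordDir d) (Icc 0 T ×ˢ univ) M m f →
      ∃ F : SpaceTime d → ℝ, EqOn F f (Icc 0 T ×ˢ univ) ∧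
        BoundedDerivs (coordDir d) (Icc (-η) (T + η) ×ˢ univ) (K * M) m F := by
  obtain ⟨η, hη, hmη⟩ : ∃ η, 0 < η ∧ m * η ≤ T := by
    refine ⟨T / (m + 1), by positivity, ?_⟩
    rw [mul_div_assoc', div_le_iff₀ (by positivity)]
    nlinarith
  have hstep : ∀ u s : ℝ, 0 ≤ u → u ≤ η → s ∈ Icc (1 : ℝ) (1 + m) →
      0 ≤ (s - 1) * u ∧ (s - 1) * u ≤ T := fun u s hu huη hs =>
    ⟨mul_nonneg (by linarith [hs.1]) hu,
      (mul_le_mul (by linarith [hs.2]) huη hu (Nat.cast_nonneg m)).trans hmη⟩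
  obtain ⟨K₁, hK₁, hright⟩ := exists_extension_across_time d m 1 T
    (I := Icc 0 T) (J := Icc 0 (T + η)) (fun u hu huT => ⟨hu.1, by linarith⟩)
    (fun u hu huT s hs => by
      have := hstep (u - T) s (by linarith) (by linarith [hu.2]) hs
      constructor <;> linarith)
  obtain ⟨K₂, hK₂, hleft⟩ := exists_extension_across_time d m (-1) 0
    (I := Icc 0 (T + η)) (J := Icc (-η) (T + η)) (fun u hu hu0 => ⟨by linarith, hu.2⟩)
    (fun u hu hu0 s hs => by
      have := hstep (-u) s (by linarith) (by linarith [hu.1]) hs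
      constructor <;> linarith)
  refine ⟨K₂ * K₁, mul_nonneg hK₂ hK₁, η, hη, fun f M hM hf => ?_⟩
  obtain ⟨F₁, hF₁, hb₁⟩ := hright f M hM hf
  obtain ⟨F₂, hF₂, hb₂⟩ := hleft F₁ (K₁ * M) (mul_nonneg hK₁ hM) hb₁
  refine ⟨F₂, fun z ⟨⟨hz0, hzT⟩, _⟩ => ?_, by rwa [mul_assoc]⟩
  rw [hF₂ ⟨⟨⟨by linarith, by linarith⟩, by linarith⟩, trivial⟩,
    hF₁ ⟨⟨⟨hz0, by linarith⟩, by linarith⟩, trivial⟩]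

theorem HasSmoothBoundary.exists_extension (hΩ : HasSmoothBoundary Ω) (hΩo : IsOpen Ω)
    (hΩb : Bornology.IsBounded Ω) {T : ℝ} (hT : 0 < T) (m : ℕ) :
    ∃ K R, 0 ≤ K ∧ ∀ (f : SpaceTime d → ℝ) (M : ℝ), 0 ≤ M →
      BoundedDerivs (coordDir d) (Icc 0 T ×ˢ closure Ω) M m f →
      ∃ F : SpaceTime d → ℝ, EqOn F f (Icc 0 T ×ˢ closure Ω) ∧
        BoundedDerivs (coordDir d) univ (K * M) m F ∧ ∀ z, F z ≠ 0 → ‖z‖ ≤ R := by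
  obtain ⟨K₁, hK₁, hspace⟩ := hΩ.exists_space_extension hΩo hΩb m (Icc 0 T)
  obtain ⟨K₂, hK₂, η, hη, htime⟩ := exists_time_extension d m hT
  obtain ⟨r, hr⟩ := hΩb.closure.subset_ball 0
  let U : Set (SpaceTime d) := Ioo (-η) (T + η) ×ˢ Metric.ball 0 r
  have hUo : IsOpen U := isOpen_Ioo.prod Metric.isOpen_ball
  have hUb : Bornology.IsBounded U := (Metric.isBounded_Ioo _ _).prod Metric.isBounded_ball
  obtain ⟨χ, hχ, hχc, hχU, hχ1⟩ := exists_contDiff_partition (κ := Unit)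
    (isClosed_Icc.prod isClosed_closure : IsClosed (Icc 0 T ×ˢ closure Ω)) (fun _ => U)
    (fun _ => hUo) (fun _ => hUb) (by
      rw [iUnion_const]
      exact prod_mono (Icc_subset_Ioo (by linarith) (by linarith)) hr)
  obtain ⟨A, hA, hAb⟩ := BoundedDerivs.exists_of_hasCompactSupport_comp (dir := coordDir d)
    (ContinuousLinearMap.id ℝ (SpaceTime d)) (hχ ()) (hχc ()) m
  obtain ⟨R, hR⟩ := hUb.exists_norm_le
  refine ⟨2 ^ m * (A * (K₂ * K₁)), R, by positivity, fun f M hM hf => ?_⟩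
  obtain ⟨F₁, hF₁, hb₁⟩ := hspace f M hM hf
  obtain ⟨F₂, hF₂, hb₂⟩ := htime F₁ (K₁ * M) (mul_nonneg hK₁ hM) hb₁
  refine ⟨fun z => χ () z * F₂ z, fun z hz => ?_, ?_, fun z hz => ?_⟩
  · have hχz : χ () z = 1 := by simpa using hχ1 z hz
    beta_reduce
    rw [hχz, one_mul, hF₂ ⟨hz.1, trivial⟩, hF₁ hz]
  · exact (BoundedDerivs.cutoff_mul (S := univ) (by positivity) hA hUo (hχU ()) hAb
      (hb₂.mono_set fun z hz => ⟨Ioo_subset_Icc_self hz.2.1, trivial⟩)).mono_bound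
        (le_of_eq (by ring))
  · exact hR z (hχU () (subset_tsupport _ (left_ne_zero_of_mul hz)))

end Extension

/-! ### An algebraic Jackson kernel -/

section Jackson

open Polynomial

/-- The polynomial `T_{2n+1}(x) / x`, where `T` denotes Chebyshev polynomials. On `[-1, 1]` its
fourth power concentrates near `0` like the Jackson kernel. -/
noncomputable def chebyshevQuotient (n : ℕ) : ℝ[X] := (Chebyshev.T ℝ (2 * n + 1)).divX

theorem abs_eval_chebyshev_T_sin (n : ℕ) (θ : ℝ) :
    |(Chebyshev.T ℝ (2 * n + 1)).eval (Real.sin θ)| = |Real.sin ((2 * n + 1) * θ)| := by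
  rw [← Real.cos_pi_div_two_sub, Chebyshev.T_real_cos]
  push_cast
  have hangle : (2 * (n : ℝ) + 1) * (Real.pi / 2 - θ) =
      (Real.pi / 2 - (2 * n + 1) * θ) + n * Real.pi := by ring
  rw [hangle, Real.cos_add_nat_mul_pi, Real.cos_pi_div_two_sub, abs_mul, abs_pow, abs_neg, abs_one,
    one_pow, one_mul]

theorem eval_chebyshevQuotient_mul (n : ℕ) (x : ℝ) :
    (chebyshevQuotient n).eval x * x = (Chebyshev.T ℝ (2 * n + 1)).eval x := by
  have h := congrArg (eval x) (divX_mul_X_add (Chebyshev.T ℝ (2 * n + 1)))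
  rwa [coeff_zero_eq_eval_zero, Chebyshev.T_eval_zero_of_odd ℝ (odd_two_mul_add_one _), map_zero,
    add_zero, eval_mul, eval_X] at h

theorem natDegree_chebyshevQuotient_le (n : ℕ) : (chebyshevQuotient n).natDegree ≤ 2 * n := by
  rw [chebyshevQuotient, natDegree_divX_eq_natDegree_tsub_one, Chebyshev.natDegree_T]
  omega

theorem abs_chebyshevQuotient_mul_le (n : ℕ) {x : ℝ} (hx : |x| ≤ 1) :
    |(chebyshevQuotient n).eval x| * |x| ≤ 1 := by
  rw [← abs_mul, eval_chebyshevQuotient_mul]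
  exact Chebyshev.abs_eval_T_real_le_one _ hx

theorem arcsin_le_pi_div_two_mul {x : ℝ} (hx0 : 0 ≤ x) (hx1 : x ≤ 1) :
    Real.arcsin x ≤ Real.pi / 2 * x := by
  have h := Real.mul_le_sin (Real.arcsin_nonneg.2 hx0) (Real.arcsin_le_pi_div_two x)
  rw [Real.sin_arcsin (by linarith) hx1] at h
  calc Real.arcsin x = Real.pi / 2 * (2 / Real.pi * Real.arcsin x) := by
        field_simp
    _ ≤ Real.pi / 2 * x := by gcongr

theorem le_abs_chebyshevQuotient (n : ℕ) {x : ℝ} (hx : 0 < x) (hxn : x ≤ 1 / (2 * n + 1)) :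
    (2 * n + 1 : ℝ) / 2 ≤ |(chebyshevQuotient n).eval x| := by
  have hxn' : (2 * n + 1) * x ≤ 1 := (le_div_iff₀' (by positivity)).1 hxn
  have hx1 : x ≤ 1 := by nlinarith
  have hsin : Real.sin (Real.arcsin x) = x := Real.sin_arcsin (by linarith) hx1
  have harcsin : 0 ≤ Real.arcsin x := Real.arcsin_nonneg.2 hx.le
  have hangle : (2 * n + 1) * Real.arcsin x ≤ Real.pi / 2 :=
    calc (2 * n + 1) * Real.arcsin x ≤ (2 * n + 1) * (Real.pi / 2 * x) := by
          gcongr; exact arcsin_le_pi_div_two_mul hx.le hx1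
      _ = Real.pi / 2 * ((2 * n + 1) * x) := by ring
      _ ≤ Real.pi / 2 := mul_le_of_le_one_right (by positivity) hxn'
  have hpi : (1 : ℝ) / 2 ≤ 2 / Real.pi := by
    rw [div_le_div_iff₀ two_pos Real.pi_pos]
    linarith [Real.pi_le_four]
  have hbound : (2 * n + 1 : ℝ) / 2 * x ≤ |(chebyshevQuotient n).eval x| * x :=
    calc (2 * n + 1 : ℝ) / 2 * x = 1 / 2 * ((2 * n + 1) * x) := by ring
      _ ≤ 2 / Real.pi * ((2 * n + 1) * Real.arcsin x) := by
          gcongr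
          exact hsin.symm.trans_le (Real.sin_le harcsin)
      _ ≤ |Real.sin ((2 * n + 1) * Real.arcsin x)| :=
          (Real.mul_le_sin (by positivity) hangle).trans (le_abs_self _)
      _ = |(chebyshevQuotient n).eval x| * x := by
          rw [← abs_eval_chebyshev_T_sin, hsin, ← eval_chebyshevQuotient_mul, abs_mul,
            abs_of_pos hx]
  exact le_of_mul_le_mul_right hbound hx

theorem integral_neg_self_comp_abs {g : ℝ → ℝ} (hg : Continuous g) (b : ℝ) (hb : 0 ≤ b) :
    ∫ x in -b..b, g |x| = 2 * ∫ x in 0..b, g x := by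
  have hgabs : Continuous fun x => g |x| := hg.comp continuous_abs
  have hneg : ∫ x in -b..0, g |x| = ∫ x in 0..b, g |x| := by
    simpa using (intervalIntegral.integral_comp_neg (a := 0) (b := b) fun x => g |x|).symm
  have hpos : ∫ x in 0..b, g |x| = ∫ x in 0..b, g x :=
    intervalIntegral.integral_congr fun x hx => by
      rw [uIcc_of_le hb] at hx
      simp only [abs_of_nonneg hx.1]
  rw [← intervalIntegral.integral_add_adjacent_intervals (b := 0) (hgabs.intervalIntegrable _ _)
    (hgabs.intervalIntegrable _ _), hneg, hpos, two_mul]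

theorem integral_abs_div_sq_add_sq_sq_le {h : ℝ} (hh : 0 < h) :
    ∫ x in -1..1, |x| / (h ^ 2 + x ^ 2) ^ 2 ≤ 1 / h ^ 2 := by
  have hne : ∀ x : ℝ, h ^ 2 + x ^ 2 ≠ 0 := fun x => by positivity
  have hcont : Continuous fun x : ℝ => x / (h ^ 2 + x ^ 2) ^ 2 :=
    continuous_id.div (by fun_prop) fun x => pow_ne_zero 2 (hne x)
  have hderiv : ∀ x : ℝ, HasDerivAt (fun x : ℝ => -((h ^ 2 + x ^ 2)⁻¹ / 2))
      (x / (h ^ 2 + x ^ 2) ^ 2) x := fun x => by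
    have hsq : HasDerivAt (fun x : ℝ => h ^ 2 + x ^ 2) (2 * x) x := by
      simpa using (hasDerivAt_pow 2 x).const_add (h ^ 2)
    refine ((hsq.inv (hne x)).div_const 2).neg.congr_deriv ?_
    field_simp
  calc ∫ x in -1..1, |x| / (h ^ 2 + x ^ 2) ^ 2
      = 2 * ∫ x in 0..1, x / (h ^ 2 + x ^ 2) ^ 2 := by
        simpa only [sq_abs] using integral_neg_self_comp_abs hcont 1 zero_le_one
    _ = 1 / h ^ 2 - (h ^ 2 + 1)⁻¹ := by
        rw [intervalIntegral.integral_eq_sub_of_hasDerivAt (fun x _ => hderiv x)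
          (hcont.intervalIntegrable _ _)]
        norm_num
        ring
    _ ≤ 1 / h ^ 2 := sub_le_self _ (by positivity)

theorem le_integral_chebyshevQuotient_pow (n : ℕ) :
    (2 * n + 1 : ℝ) ^ 3 / 32 ≤ ∫ x in -1..1, (chebyshevQuotient n).eval x ^ 4 := by
  obtain ⟨h, hh⟩ : ∃ h : ℝ, h = 1 / (2 * n + 1) := ⟨_, rfl⟩
  have hh0 : 0 < h := hh ▸ by positivity
  have hh1 : h ≤ 1 := hh ▸ (div_le_one (by positivity)).2 (by simp)
  have hcont : Continuous fun x => (chebyshevQuotient n).eval x ^ 4 := by fun_prop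
  calc (2 * n + 1 : ℝ) ^ 3 / 32 = ∫ _ in h / 2..h, ((2 * n + 1 : ℝ) / 2) ^ 4 := by
        rw [intervalIntegral.integral_const, smul_eq_mul, hh]
        field_simp
        ring
    _ ≤ ∫ x in h / 2..h, (chebyshevQuotient n).eval x ^ 4 := by
        refine intervalIntegral.integral_mono_on (by linarith) (by simp)
          (hcont.intervalIntegrable _ _) fun x hx => ?_
        rw [← (Nat.even_iff.2 rfl : Even 4).pow_abs ((chebyshevQuotient n).eval x)]
        gcongr
        exact le_abs_chebyshevQuotient n (by linarith [hx.1]) (hx.2.trans_eq hh)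
    _ ≤ ∫ x in -1..1, (chebyshevQuotient n).eval x ^ 4 :=
        intervalIntegral.integral_mono_interval (by linarith) (by linarith) hh1
          (Filter.Eventually.of_forall fun x => by positivity) (hcont.intervalIntegrable _ _)

theorem abs_mul_chebyshevQuotient_pow_le (n : ℕ) {x h : ℝ} (hx : |x| ≤ 1) (hh : 0 < h) :
    |x| * (chebyshevQuotient n).eval x ^ 4 ≤
      h * (chebyshevQuotient n).eval x ^ 4 + 4 * (|x| / (h ^ 2 + x ^ 2) ^ 2) := by
  rcases le_or_gt |x| h with hxh | hxh
  · exact (mul_le_mul_of_nonneg_right hxh (by positivity)).trans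
      (le_add_of_nonneg_right (by positivity))
  · refine le_add_of_nonneg_of_le (by positivity) ?_
    have hq : (chebyshevQuotient n).eval x ^ 4 * |x| ^ 4 ≤ 1 := by
      rw [← (Nat.even_iff.2 rfl : Even 4).pow_abs ((chebyshevQuotient n).eval x), ← mul_pow]
      exact pow_le_one₀ (by positivity) (abs_chebyshevQuotient_mul_le n hx)
    have hdenom : (h ^ 2 + x ^ 2) ^ 2 ≤ 4 * |x| ^ 4 :=
      calc (h ^ 2 + x ^ 2) ^ 2 ≤ (|x| ^ 2 + |x| ^ 2) ^ 2 := by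
            rw [← sq_abs x]; gcongr
        _ = 4 * |x| ^ 4 := by ring
    rw [mul_div_assoc', le_div_iff₀ (by positivity)]
    calc |x| * (chebyshevQuotient n).eval x ^ 4 * (h ^ 2 + x ^ 2) ^ 2
        ≤ |x| * (chebyshevQuotient n).eval x ^ 4 * (4 * |x| ^ 4) := by gcongr
      _ = 4 * |x| * ((chebyshevQuotient n).eval x ^ 4 * |x| ^ 4) := by ring
      _ ≤ 4 * |x| := mul_le_of_le_one_right (by positivity) hq

theorem integral_abs_mul_chebyshevQuotient_pow_le (n : ℕ) :
    ∫ x in -1..1, |x| * (chebyshevQuotient n).eval x ^ 4 ≤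
      129 / (2 * n + 1) * ∫ x in -1..1, (chebyshevQuotient n).eval x ^ 4 := by
  obtain ⟨h, hh⟩ : ∃ h : ℝ, h = 1 / (2 * n + 1) := ⟨_, rfl⟩
  have hh0 : 0 < h := hh ▸ by positivity
  have hq : Continuous fun x => (chebyshevQuotient n).eval x ^ 4 := by fun_prop
  have hg : Continuous fun x : ℝ => |x| / (h ^ 2 + x ^ 2) ^ 2 :=
    continuous_abs.div (by fun_prop) fun x => by positivity
  have hqi : IntervalIntegrable (fun x => h * (chebyshevQuotient n).eval x ^ 4) volume (-1) 1 :=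
    (continuous_const.mul hq).intervalIntegrable _ _
  have hgi : IntervalIntegrable (fun x => 4 * (|x| / (h ^ 2 + x ^ 2) ^ 2)) volume (-1) 1 :=
    (continuous_const.mul hg).intervalIntegrable _ _
  have htail : 1 / h ^ 2 ≤ 32 * h * ∫ x in -1..1, (chebyshevQuotient n).eval x ^ 4 := by
    calc 1 / h ^ 2 = 32 * h * ((2 * n + 1 : ℝ) ^ 3 / 32) := by rw [hh]; field_simp
      _ ≤ _ := by gcongr; exact le_integral_chebyshevQuotient_pow n
  calc ∫ x in -1..1, |x| * (chebyshevQuotient n).eval x ^ 4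
      ≤ ∫ x in -1..1,
          (h * (chebyshevQuotient n).eval x ^ 4 + 4 * (|x| / (h ^ 2 + x ^ 2) ^ 2)) :=
        intervalIntegral.integral_mono_on (by norm_num)
          ((continuous_abs.mul hq).intervalIntegrable _ _)
          (hqi.add hgi) fun x hx => abs_mul_chebyshevQuotient_pow_le n (abs_le.2 hx) hh0
    _ = h * (∫ x in -1..1, (chebyshevQuotient n).eval x ^ 4) +
          4 * ∫ x in -1..1, |x| / (h ^ 2 + x ^ 2) ^ 2 := by
        rw [intervalIntegral.integral_add hqi hgi, intervalIntegral.integral_const_mul,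
          intervalIntegral.integral_const_mul]
    _ ≤ h * (∫ x in -1..1, (chebyshevQuotient n).eval x ^ 4) +
          4 * (32 * h * ∫ x in -1..1, (chebyshevQuotient n).eval x ^ 4) := by
        gcongr
        exact (integral_abs_div_sq_add_sq_sq_le hh0).trans htail
    _ = _ := by rw [hh]; ring

theorem exists_jackson_kernel {b : ℝ} (hb : 0 < b) {n : ℕ} (hn : 1 ≤ n) :
    ∃ p : ℝ[X], p.natDegree ≤ 8 * n ∧ (∀ x, 0 ≤ p.eval x) ∧ ∫ x in -b..b, p.eval x = 1 ∧
      ∫ x in -b..b, |x| * p.eval x ≤ 129 * b / n := by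
  obtain ⟨I, hI⟩ : ∃ I, I = ∫ x in -1..1, (chebyshevQuotient n).eval x ^ 4 := ⟨_, rfl⟩
  have hI0 : 0 < I := hI ▸ lt_of_lt_of_le (by positivity) (le_integral_chebyshevQuotient_pow n)
  have heval : ∀ x, (C (b * I)⁻¹ * (chebyshevQuotient n ^ 4).comp (C b⁻¹ * X)).eval x =
      (b * I)⁻¹ * (chebyshevQuotient n).eval (x / b) ^ 4 := fun x => by
    simp only [eval_mul, eval_C, eval_comp, eval_pow, eval_X, div_eq_inv_mul]
  refine ⟨C (b * I)⁻¹ * (chebyshevQuotient n ^ 4).comp (C b⁻¹ * X), ?_, fun x => ?_, ?_, ?_⟩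
  · calc _ ≤ (chebyshevQuotient n ^ 4).natDegree * (C b⁻¹ * X).natDegree :=
          (natDegree_C_mul_le _ _).trans_eq natDegree_comp
      _ ≤ 4 * (2 * n) * 1 := Nat.mul_le_mul
          (natDegree_pow_le.trans (Nat.mul_le_mul_left 4 (natDegree_chebyshevQuotient_le n)))
          ((natDegree_C_mul_le _ _).trans natDegree_X_le)
      _ = 8 * n := by ring
  · rw [heval]
    positivity
  · simp only [heval]
    rw [intervalIntegral.integral_const_mul,
      intervalIntegral.integral_comp_div (fun x => (chebyshevQuotient n).eval x ^ 4) hb.ne',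
      neg_div, div_self hb.ne', smul_eq_mul, ← hI, inv_mul_cancel₀ (by positivity)]
  · have hscale : ∀ x, |x| * ((b * I)⁻¹ * (chebyshevQuotient n).eval (x / b) ^ 4) =
        I⁻¹ * (|x / b| * (chebyshevQuotient n).eval (x / b) ^ 4) := fun x => by
      rw [abs_div, abs_of_pos hb]
      field_simp
    simp only [heval, hscale]
    rw [intervalIntegral.integral_const_mul, intervalIntegral.integral_comp_div
      (fun x => |x| * (chebyshevQuotient n).eval x ^ 4) hb.ne', neg_div, div_self hb.ne',
      smul_eq_mul]
    have hn0 : (0 : ℝ) < n := by exact_mod_cast hn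
    calc I⁻¹ * (b * ∫ x in -1..1, |x| * (chebyshevQuotient n).eval x ^ 4)
        ≤ I⁻¹ * (b * (129 / (2 * n + 1) * I)) := by
          gcongr
          exact hI ▸ integral_abs_mul_chebyshevQuotient_pow_le n
      _ = 129 * b / (2 * n + 1) := by field_simp
      _ ≤ 129 * b / n := by gcongr; linarith

end Jackson

/-! ### Approximation by convolution with a product kernel -/

section Convolution

variable {V W : Type*} [NormedAddCommGroup V] [NormedSpace ℝ V] [NormedAddCommGroup W]
  [NormedSpace ℝ W] {ι : Type*} [Fintype ι]

/-- The average of `F` over translations along the directions `dir i` with product weight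
`∏ i, k (u i)`. -/
noncomputable def kernelAverage (dir : ι → V) (k : ℝ → ℝ) (F : V → W) (z : V) : W :=
  ∫ u : ι → ℝ, (∏ i, k (u i)) • F (z - ∑ i, u i • dir i)

/-- A probability density `k` on the line with first absolute moment at most `μ`. -/
structure IsAveragingKernel (k : ℝ → ℝ) (μ : ℝ) : Prop where
  nonneg : ∀ x, 0 ≤ k x
  integrable : Integrable k
  integrable_abs_mul : Integrable fun x => |x| * k x
  integral_eq_one : ∫ x, k x = 1
  integral_abs_mul_le : ∫ x, |x| * k x ≤ μ

variable {dir : ι → V} {co : ι → V →L[ℝ] ℝ} {k : ℝ → ℝ} {C M μ : ℝ} {m : ℕ}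

theorem integrable_prod_kernel (hk : Integrable k) : Integrable fun u : ι → ℝ => ∏ i, k (u i) :=
  Integrable.fintype_prod (f := fun _ => k) fun _ => hk

theorem integrable_prod_kernel_smul (hk : Integrable k) {G : V → W} (hG : Continuous G)
    (hGC : ∀ z, ‖G z‖ ≤ C) (z : V) :
    Integrable fun u : ι → ℝ => (∏ i, k (u i)) • G (z - ∑ i, u i • dir i) := by
  have htranslate : Continuous fun u : ι → ℝ => G (z - ∑ i, u i • dir i) := by fun_prop
  exact (integrable_prod_kernel hk).smul_bdd _ htranslate.aestronglyMeasurable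
    (Filter.Eventually.of_forall fun u => hGC _)

theorem abs_mul_prod_kernel_eq [DecidableEq ι] (k : ℝ → ℝ) (i : ι) (u : ι → ℝ) :
    |u i| * ∏ j, k (u j) = ∏ j, (if j = i then fun x => |x| * k x else k) (u j) := by
  have hfactor : ∀ j, (if j = i then fun x => |x| * k x else k) (u j) =
      (if j = i then |u j| else 1) * k (u j) := fun j => by split_ifs <;> simp
  simp only [hfactor, Finset.prod_mul_distrib, Finset.prod_ite_eq', Finset.mem_univ, if_true]

theorem hasFDerivAt_kernelAverage (hk : Integrable k) {F : V → W} {F' : V → V →L[ℝ] W}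
    (hF : ∀ z, HasFDerivAt F (F' z) z) (hF' : Continuous F') (hFM : ∀ z, ‖F z‖ ≤ M)
    (hF'C : ∀ z, ‖F' z‖ ≤ C) (z : V) :
    HasFDerivAt (kernelAverage dir k F) (kernelAverage dir k F' z) z := by
  have hFc : Continuous F := continuous_iff_continuousAt.2 fun z => (hF z).continuousAt
  refine hasFDerivAt_integral_of_dominated_of_fderiv_le
    (F := fun z (u : ι → ℝ) => (∏ i, k (u i)) • F (z - ∑ i, u i • dir i))
    (F' := fun z (u : ι → ℝ) => (∏ i, k (u i)) • F' (z - ∑ i, u i • dir i))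
    (s := univ) (bound := fun u => ‖∏ i, k (u i)‖ * C) Filter.univ_mem
    (Filter.Eventually.of_forall fun y =>
      (integrable_prod_kernel_smul hk hFc hFM y).aestronglyMeasurable)
    (integrable_prod_kernel_smul hk hFc hFM z)
    (integrable_prod_kernel_smul hk hF' hF'C z).aestronglyMeasurable
    (Filter.Eventually.of_forall fun u y _ => ?_) ((integrable_prod_kernel hk).norm.mul_const C)
    (Filter.Eventually.of_forall fun u y _ => ?_)
  · rw [norm_smul]
    exact mul_le_mul_of_nonneg_left (hF'C _) (norm_nonneg _)
  · exact ((hF _).comp y ((hasFDerivAt_id y).sub_const _)).const_smul _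

theorem kernelAverage_clm_apply [CompleteSpace W] (hk : Integrable k) {G : V → V →L[ℝ] W}
    (hG : Continuous G) (hGC : ∀ z, ‖G z‖ ≤ C) (z v : V) :
    kernelAverage dir k G z v = kernelAverage dir k (fun z => G z v) z :=
  ContinuousLinearMap.integral_apply (integrable_prod_kernel_smul hk hG hGC z) v

theorem norm_sub_translate_le {F : V → W} {F' : V → V →L[ℝ] W} (hF : ∀ z, HasFDerivAt F (F' z) z)
    (hF'M : ∀ i z, ‖F' z (dir i)‖ ≤ M) (z : V) (u : ι → ℝ) :
    ‖F z - F (z - ∑ i, u i • dir i)‖ ≤ M * ∑ i, |u i| := by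
  obtain ⟨v, hv⟩ : ∃ v, v = ∑ i, u i • dir i := ⟨_, rfl⟩
  have hderiv : ∀ t : ℝ, HasDerivAt (fun t : ℝ => F (z - t • v)) (F' (z - t • v) (-v)) t :=
    fun t => (hF _).comp_hasDerivAt t (by simpa using ((hasDerivAt_id t).smul_const v).const_sub z)
  have hspeed : ∀ t : ℝ, ‖F' (z - t • v) (-v)‖ ≤ M * ∑ i, |u i| := fun t => by
    rw [map_neg, norm_neg]
    nth_rewrite 2 [hv]
    rw [map_sum, Finset.mul_sum]
    refine (norm_sum_le _ _).trans (Finset.sum_le_sum fun i _ => ?_)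
    rw [map_smul, norm_smul, Real.norm_eq_abs, mul_comm]
    exact mul_le_mul_of_nonneg_right (hF'M i _) (abs_nonneg _)
  have hmvt := norm_image_sub_le_of_norm_deriv_le_segment_01' (f := fun t : ℝ => F (z - t • v))
    (fun t _ => (hderiv t).hasDerivWithinAt) fun t _ => hspeed t
  rw [← hv, norm_sub_rev]
  simpa only [one_smul, zero_smul, sub_zero] using hmvt

namespace IsAveragingKernel

theorem integrable_abs_mul_prod (hk : IsAveragingKernel k μ) (i : ι) :
    Integrable fun u : ι → ℝ => |u i| * ∏ j, k (u j) := by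
  classical
  simp only [abs_mul_prod_kernel_eq]
  refine Integrable.fintype_prod (f := fun j => if j = i then fun x => |x| * k x else k) fun j => ?_
  split_ifs
  · exact hk.integrable_abs_mul
  · exact hk.integrable

theorem integral_abs_mul_prod_le (hk : IsAveragingKernel k μ) (i : ι) :
    ∫ u : ι → ℝ, |u i| * ∏ j, k (u j) ≤ μ := by
  classical
  simp only [abs_mul_prod_kernel_eq]
  rw [integral_fintype_prod_volume_eq_prod fun j => if j = i then fun x => |x| * k x else k]
  have hfactor : ∀ j, ∫ x, (if j = i then fun x => |x| * k x else k) x =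
      if j = i then ∫ x, |x| * k x else 1 := fun j => by
    split_ifs
    · rfl
    · exact hk.integral_eq_one
  simp only [hfactor, Finset.prod_ite_eq', Finset.mem_univ, if_true]
  exact hk.integral_abs_mul_le

theorem integral_prod_eq_one (hk : IsAveragingKernel k μ) :
    ∫ u : ι → ℝ, ∏ i, k (u i) = 1 := by
  rw [integral_fintype_prod_volume_eq_prod fun _ => k, Finset.prod_congr rfl fun _ _ =>
    hk.integral_eq_one, Finset.prod_const_one]

theorem norm_sub_kernelAverage_le [CompleteSpace W] (hk : IsAveragingKernel k μ) (hM : 0 ≤ M)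
    {F : V → W} {F' : V → V →L[ℝ] W} (hF : ∀ z, HasFDerivAt F (F' z) z) (hFM : ∀ z, ‖F z‖ ≤ M)
    (hF'M : ∀ i z, ‖F' z (dir i)‖ ≤ M) (z : V) :
    ‖F z - kernelAverage dir k F z‖ ≤ Fintype.card ι * μ * M := by
  have hFc : Continuous F := continuous_iff_continuousAt.2 fun z => (hF z).continuousAt
  have hmoment := fun i : ι => (hk.integrable_abs_mul_prod i).const_mul M
  have hdiff : F z - kernelAverage dir k F z =
      ∫ u : ι → ℝ, (∏ i, k (u i)) • (F z - F (z - ∑ i, u i • dir i)) := by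
    simp only [smul_sub]
    rw [integral_sub ((integrable_prod_kernel hk.integrable).smul_const _)
      (integrable_prod_kernel_smul hk.integrable hFc hFM z), integral_smul_const,
      hk.integral_prod_eq_one, one_smul]
    rfl
  calc ‖F z - kernelAverage dir k F z‖
      ≤ ∫ u : ι → ℝ, ∑ i, M * (|u i| * ∏ j, k (u j)) := by
        rw [hdiff]
        refine norm_integral_le_of_norm_le (integrable_finsetSum _ fun i _ => hmoment i)
          (Filter.Eventually.of_forall fun u => ?_)
        have hweight : 0 ≤ ∏ i, k (u i) := Finset.prod_nonneg fun i _ => hk.nonneg _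
        rw [norm_smul, Real.norm_of_nonneg hweight, ← Finset.mul_sum, ← Finset.sum_mul, ← mul_assoc,
          mul_comm]
        exact mul_le_mul_of_nonneg_right (norm_sub_translate_le hF hF'M z u) hweight
    _ = ∑ i, M * ∫ u : ι → ℝ, |u i| * ∏ j, k (u j) := by
        rw [integral_finsetSum _ fun i _ => hmoment i]
        simp only [integral_const_mul]
    _ ≤ ∑ _i : ι, M * μ :=
        Finset.sum_le_sum fun i _ => mul_le_mul_of_nonneg_left (hk.integral_abs_mul_prod_le i) hM
    _ = Fintype.card ι * μ * M := by
        rw [Finset.sum_const, Finset.card_univ, nsmul_eq_mul]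
        ring

end IsAveragingKernel

theorem clm_eq_sum_smul (hco : ∀ z, ∑ i, co i z • dir i = z) (L : V →L[ℝ] ℝ) :
    L = ∑ i, L (dir i) • co i := by
  ext v
  conv_lhs => rw [← hco v]
  simp [mul_comm]

theorem continuous_of_forall_apply_dir (hco : ∀ z, ∑ i, co i z • dir i = z) {L : V → V →L[ℝ] ℝ}
    (hL : ∀ i, Continuous fun z => L z (dir i)) : Continuous L := by
  rw [funext fun z => clm_eq_sum_smul hco (L z)]
  exact continuous_finsetSum _ fun i _ => (hL i).smul continuous_const

theorem norm_le_of_forall_apply_dir_le (hco : ∀ z, ∑ i, co i z • dir i = z) {L : V →L[ℝ] ℝ}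
    (hL : ∀ i, |L (dir i)| ≤ M) : ‖L‖ ≤ ∑ i, M * ‖co i‖ := by
  rw [clm_eq_sum_smul hco L]
  refine (norm_sum_le _ _).trans (Finset.sum_le_sum fun i _ => ?_)
  rw [norm_smul]
  exact mul_le_mul_of_nonneg_right (hL i) (norm_nonneg _)

theorem BoundedDerivs.abs_sub_kernelAverage_le (hk : IsAveragingKernel k μ) (hM : 0 ≤ M)
    {F : V → ℝ} (hF : BoundedDerivs dir univ M (m + 1) F) (z : V) :
    |F z - kernelAverage dir k F z| ≤ Fintype.card ι * μ * M := by
  obtain ⟨hFM, F', hF', hF'M⟩ := hF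
  exact hk.norm_sub_kernelAverage_le hM (fun z => hasFDerivWithinAt_univ.1 (hF' z trivial))
    (fun z => hFM z trivial) (fun i z => (hF'M i).abs_le z trivial) z

theorem BoundedDerivs.exists_hasFDerivAt_sub_kernelAverage (hk : Integrable k)
    (hco : ∀ z, ∑ i, co i z • dir i = z) {F : V → ℝ} (hF : BoundedDerivs dir univ M (m + 1) F) :
    ∃ F' L : V → V →L[ℝ] ℝ, (∀ i, BoundedDerivs dir univ M m fun z => F' z (dir i)) ∧
      (∀ z, HasFDerivAt (fun z => F z - kernelAverage dir k F z) (L z) z) ∧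
      ∀ i z, L z (dir i) = F' z (dir i) - kernelAverage dir k (fun z => F' z (dir i)) z := by
  obtain ⟨hFM, F', hF', hF'M⟩ := hF
  simp only [mem_univ, hasFDerivWithinAt_univ, forall_const] at hFM hF'
  have hF'c := continuous_of_forall_apply_dir hco fun i =>
    continuousOn_univ.1 (hF'M i).continuousOn
  have hF'C := fun z => norm_le_of_forall_apply_dir_le hco fun i => (hF'M i).abs_le z trivial
  refine ⟨F', fun z => F' z - kernelAverage dir k F' z, hF'M, fun z =>
    (hF' z).sub (hasFDerivAt_kernelAverage hk hF' hF'c hFM hF'C z), fun i z => ?_⟩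
  rw [sub_apply, kernelAverage_clm_apply hk hF'c hF'C]

theorem BoundedDerivs.sub_kernelAverage (hk : IsAveragingKernel k μ) (hM : 0 ≤ M)
    (hco : ∀ z, ∑ i, co i z • dir i = z) {F : V → ℝ} (hF : BoundedDerivs dir univ M (m + 1) F) :
    BoundedDerivs dir univ (Fintype.card ι * μ * M) m
      (fun z => F z - kernelAverage dir k F z) := by
  induction m generalizing F with
  | zero =>
    obtain ⟨_, _, -, hL, -⟩ := hF.exists_hasFDerivAt_sub_kernelAverage hk.integrable hco
    exact ⟨fun z _ => (hL z).continuousAt.continuousWithinAt,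
      fun z _ => hF.abs_sub_kernelAverage_le hk hM z⟩
  | succ m ih =>
    obtain ⟨F', L, hF', hL, hLdir⟩ := hF.exists_hasFDerivAt_sub_kernelAverage hk.integrable hco
    exact ⟨fun z _ => hF.abs_sub_kernelAverage_le hk hM z, L, fun z _ => (hL z).hasFDerivWithinAt,
      fun i => (ih (hF' i)).congr fun z _ => hLdir i z⟩

theorem kernelAverage_indicator_eq_integral {b : ℝ} (hco : ∀ z, ∑ i, co i z • dir i = z)
    (hdual : ∀ (u : ι → ℝ) i, co i (∑ j, u j • dir j) = u i) {F : V → W}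
    (hsupp : ∀ z, F z ≠ 0 → ∀ i, |co i z| ≤ b) (q : ℝ → ℝ) {z : V} (hz : ∀ i, |co i z| ≤ b) :
    kernelAverage dir (indicator (Icc (-(2 * b)) (2 * b)) q) F z =
      ∫ y : ι → ℝ, (∏ i, q (co i z - y i)) • F (∑ j, y j • dir j) := by
  rw [← integral_sub_left_eq_self _ volume (fun i => co i z)]
  refine integral_congr_ae (Filter.Eventually.of_forall fun u => ?_)
  have hpt : z - ∑ i, u i • dir i = ∑ i, (co i z - u i) • dir i := by
    simp only [sub_smul, Finset.sum_sub_distrib, hco]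
  simp only [hpt, Pi.sub_apply, sub_sub_cancel]
  by_cases hF : F (∑ i, (co i z - u i) • dir i) = 0
  · rw [hF, smul_zero, smul_zero]
  · congr 1
    refine Finset.prod_congr rfl fun i _ => indicator_of_mem (mem_Icc.2 (abs_le.1 ?_)) _
    have hzu := hsupp _ hF i
    rw [hdual fun i => co i z - u i] at hzu
    calc |u i| = |co i z - (co i z - u i)| := by rw [sub_sub_cancel]
      _ ≤ |co i z| + |co i z - u i| := abs_sub _ _
      _ ≤ 2 * b := by linarith [hz i]

theorem eval_sub_eq_sum_hasseDeriv {R : Type*} [CommRing R] {p : Polynomial R} {n : ℕ}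
    (hp : p.natDegree ≤ n) (x y : R) :
    p.eval (x - y) =
      ∑ l : Fin (n + 1), (Polynomial.hasseDeriv (l : ℕ) p).eval (-y) * x ^ (l : ℕ) := by
  rw [sub_eq_add_neg, ← Polynomial.taylor_eval,
    Polynomial.eval_eq_sum_range' (n := n + 1) (by rw [Polynomial.natDegree_taylor]; omega),
    Finset.sum_range]
  simp only [Polynomial.taylor_coeff]

theorem exists_kernelAverage_eq_sum [DecidableEq ι] {b : ℝ} (hco : ∀ z, ∑ i, co i z • dir i = z)
    (hdual : ∀ (u : ι → ℝ) i, co i (∑ j, u j • dir j) = u i) {F : V → ℝ} (hF : Continuous F)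
    (hsupp : ∀ z, F z ≠ 0 → ∀ i, |co i z| ≤ b) {p : Polynomial ℝ} {n : ℕ} (hp : p.natDegree ≤ n) :
    ∃ β : (ι → Fin (n + 1)) → ℝ, ∀ z, (∀ i, |co i z| ≤ b) →
      kernelAverage dir (indicator (Icc (-(2 * b)) (2 * b)) fun x => p.eval x) F z =
        ∑ α, β α * ∏ i, co i z ^ (α i : ℕ) := by
  have hsupport : HasCompactSupport fun y : ι → ℝ => F (∑ j, y j • dir j) := by
    refine HasCompactSupport.intro (isCompact_univ_pi fun _ : ι => isCompact_Icc (a := -b) (b := b))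
      fun y hy => ?_
    by_contra hne
    exact hy fun i _ => abs_le.1 (by simpa only [hdual] using hsupp _ hne i)
  let γ : (ι → Fin (n + 1)) → (ι → ℝ) → ℝ := fun α y =>
    (∏ i, (Polynomial.hasseDeriv (α i : ℕ) p).eval (-y i)) * F (∑ j, y j • dir j)
  have hγ : ∀ α, Integrable (γ α) := fun α => by
    have hcont : Continuous (γ α) := by fun_prop
    exact hcont.integrable_of_hasCompactSupport hsupport.mul_left
  have hexpand : ∀ (z : V) (y : ι → ℝ), (∏ i, p.eval (co i z - y i)) • F (∑ j, y j • dir j) =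
      ∑ α : ι → Fin (n + 1), γ α y * ∏ i, co i z ^ (α i : ℕ) := fun z y => by
    simp only [eval_sub_eq_sum_hasseDeriv hp, Fintype.prod_sum, Finset.sum_mul, smul_eq_mul,
      Finset.prod_mul_distrib, γ, mul_right_comm]
  refine ⟨fun α => ∫ y, γ α y, fun z hz => ?_⟩
  rw [kernelAverage_indicator_eq_integral hco hdual hsupp _ hz]
  simp only [hexpand]
  rw [integral_finsetSum _ fun α _ => (hγ α).mul_const _]
  simp only [integral_mul_const]

theorem exists_isAveragingKernel_polynomial {b : ℝ} (hb : 0 < b) {n : ℕ} (hn : 1 ≤ n) :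
    ∃ p : Polynomial ℝ, p.natDegree ≤ 8 * n ∧
      IsAveragingKernel (indicator (Icc (-b) b) fun x => p.eval x) (129 * b / n) := by
  obtain ⟨p, hdeg, hp0, hp1, hpμ⟩ := exists_jackson_kernel hb hn
  have hle : -b ≤ b := by linarith
  have hmoment : (fun x => |x| * indicator (Icc (-b) b) (fun x => p.eval x) x) =
      indicator (Icc (-b) b) fun x => |x| * p.eval x :=
    funext fun x => (indicator_mul_right _ (fun x => |x|) _).symm
  have hintegrable : ∀ g : ℝ → ℝ, Continuous g → Integrable (indicator (Icc (-b) b) g) :=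
    fun g hg => (integrable_indicator_iff measurableSet_Icc).2 hg.continuousOn.integrableOn_Icc
  have hintegral : ∀ g : ℝ → ℝ, ∫ x, indicator (Icc (-b) b) g x = ∫ x in -b..b, g x := fun g => by
    rw [integral_indicator measurableSet_Icc, integral_Icc_eq_integral_Ioc,
      ← intervalIntegral.integral_of_le hle]
  refine ⟨p, hdeg, fun x => indicator_nonneg (fun x _ => hp0 x) x, hintegrable _ p.continuous, ?_,
    (hintegral _).trans hp1, ?_⟩
  · rw [hmoment]
    exact hintegrable _ (continuous_abs.mul p.continuous)
  · rw [hmoment, hintegral]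
    exact hpμ

/-- Jackson's theorem, for a function together with its derivatives. -/
theorem BoundedDerivs.exists_polynomial_approx [DecidableEq ι] {b : ℝ} (hb : 0 < b)
    (hM : 0 ≤ M) (hco : ∀ z, ∑ i, co i z • dir i = z)
    (hdual : ∀ (u : ι → ℝ) i, co i (∑ j, u j • dir j) = u i) {F : V → ℝ}
    (hF : BoundedDerivs dir univ M (m + 1) F) (hsupp : ∀ z, F z ≠ 0 → ∀ i, |co i z| ≤ b)
    {n : ℕ} (hn : 1 ≤ n) :
    ∃ β : (ι → Fin (8 * n + 1)) → ℝ,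
      BoundedDerivs dir {z | ∀ i, |co i z| ≤ b} (Fintype.card ι * (129 * (2 * b) / n) * M) m
        (fun z => F z - ∑ α, β α * ∏ i, co i z ^ (α i : ℕ)) := by
  obtain ⟨p, hdeg, hk⟩ := exists_isAveragingKernel_polynomial (b := 2 * b) (by positivity) hn
  obtain ⟨β, hβ⟩ := exists_kernelAverage_eq_sum hco hdual (continuousOn_univ.1 hF.continuousOn)
    hsupp hdeg
  exact ⟨β, ((hF.sub_kernelAverage hk hM hco).mono_set (subset_univ _)).congr fun z hz =>
    congrArg (F z - ·) (hβ z hz).symm⟩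

end Convolution

/-! ### Smooth activation functions -/

section Activation

open Polynomial in
theorem exists_derivative_eq {K : Type*} [Field K] [CharZero K] (p : K[X]) :
    ∃ P : K[X], derivative P = p := by
  induction p using Polynomial.induction_on' with
  | add p q hp hq =>
    obtain ⟨P, rfl⟩ := hp
    obtain ⟨R, rfl⟩ := hq
    exact ⟨P + R, derivative_add⟩
  | monomial n a =>
    refine ⟨monomial (n + 1) (a / (n + 1)), ?_⟩
    rw [derivative_monomial, Nat.cast_add_one, div_mul_cancel₀ _ n.cast_add_one_ne_zero]
    rfl

open Polynomial in
theorem exists_polynomial_of_deriv {σ : ℝ → ℝ} (hσ : Differentiable ℝ σ)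
    (h : ∃ p : ℝ[X], ∀ y, deriv σ y = p.eval y) : ∃ p : ℝ[X], ∀ y, σ y = p.eval y := by
  obtain ⟨p, hp⟩ := h
  obtain ⟨P, hP⟩ := exists_derivative_eq p
  have hconst := is_const_of_deriv_eq_zero (f := fun y => σ y - P.eval y) (hσ.sub P.differentiable)
    fun y => by rw [deriv_fun_sub (hσ y) P.differentiableAt, hp, Polynomial.deriv, hP, sub_self]
  refine ⟨P + C (σ 0 - P.eval 0), fun y => ?_⟩
  rw [eval_add, eval_C, ← hconst y 0, add_sub_cancel]

theorem exists_isOpen_iteratedDeriv_ne_zero {σ : ℝ → ℝ} (hσ : ContDiff ℝ ∞ σ)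
    (hp : ¬ ∃ p : Polynomial ℝ, ∀ y, σ y = p.eval y) (J : ℕ) :
    ∃ U : Set ℝ, IsOpen U ∧ U.Nonempty ∧ ∀ x ∈ U, ∀ j ≤ J, iteratedDeriv j σ x ≠ 0 := by
  have hopen : IsOpen {x | σ x ≠ 0} := isOpen_ne_fun hσ.continuous continuous_const
  induction J generalizing σ with
  | zero =>
    refine ⟨{x | σ x ≠ 0}, hopen, ?_, fun x hx j hj => ?_⟩
    · by_contra! hempty
      exact hp ⟨0, fun y => by_contra fun hy => hempty.subset (by rwa [Polynomial.eval_zero] at hy)⟩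
    · rwa [Nat.le_zero.1 hj, iteratedDeriv_zero]
  | succ J ih =>
    have hσ' : ContDiff ℝ ∞ (deriv σ) := hσ.deriv'
    obtain ⟨U, hU, ⟨x, hx⟩, hne⟩ := ih hσ'
      (fun h => hp (exists_polynomial_of_deriv (hσ.differentiable (by simp)) h))
      (isOpen_ne_fun hσ'.continuous continuous_const)
    refine ⟨U ∩ {x | σ x ≠ 0}, hU.inter hopen, ?_, ?_⟩
    · by_contra! hempty
      have hσ0 : σ =ᶠ[𝓝 x] fun _ => 0 := by
        filter_upwards [hU.mem_nhds hx] with y hy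
        exact by_contra fun hy0 => hempty.subset ⟨hy, hy0⟩
      exact hne x hx 0 J.zero_le (by rw [iteratedDeriv_zero, hσ0.deriv_eq, deriv_const])
    · rintro x ⟨hxU, hx0⟩ (_ | j) hj
      · rwa [iteratedDeriv_zero]
      · rw [iteratedDeriv_succ']
        exact hne x hxU j (by omega)

/-- The remainder of the Taylor polynomial of degree `s` at `b`, as a function of the increment. -/
noncomputable def taylorRemainder (σ : ℝ → ℝ) (b : ℝ) (s : ℕ) (y : ℝ) : ℝ :=
  σ (b + y) - taylorWithinEval σ s univ b (b + y)

theorem taylorRemainder_eq (σ : ℝ → ℝ) (b : ℝ) (s : ℕ) (y : ℝ) : taylorRemainder σ b s y =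
    σ (b + y) - ∑ j ∈ Finset.range (s + 1), iteratedDeriv j σ b / j.factorial * y ^ j := by
  simp only [taylorRemainder, taylor_within_apply, iteratedDerivWithin_univ, add_sub_cancel_left,
    smul_eq_mul]
  exact congrArg _ (Finset.sum_congr rfl fun j _ => by ring)

theorem contDiff_taylorRemainder {σ : ℝ → ℝ} (hσ : ContDiff ℝ ∞ σ) (b : ℝ) (s : ℕ) :
    ContDiff ℝ ∞ (taylorRemainder σ b s) := by
  simp only [funext (taylorRemainder_eq σ b s)]
  fun_prop

theorem deriv_taylorRemainder {σ : ℝ → ℝ} (hσ : Differentiable ℝ σ) (b : ℝ) (s : ℕ) :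
    deriv (taylorRemainder σ b (s + 1)) = taylorRemainder (deriv σ) b s := by
  funext y
  have htaylor := (hasDerivAt_taylorWithinEval_succ (x₀ := b) (s := univ) σ s).comp_const_add b y
  rw [derivWithin_univ] at htaylor
  exact (((hσ _).hasDerivAt.comp_const_add b y).sub htaylor).deriv

theorem iteratedDeriv_taylorRemainder {σ : ℝ → ℝ} (hσ : ContDiff ℝ ∞ σ) (b : ℝ) {s l : ℕ}
    (hl : l < s + 1) : iteratedDeriv l (taylorRemainder σ b s) 0 = 0 := by
  induction l generalizing σ s with
  | zero => rw [iteratedDeriv_zero, taylorRemainder, add_zero, taylorWithinEval_self, sub_self]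
  | succ l ih =>
    obtain ⟨s, rfl⟩ : ∃ t, s = t + 1 := ⟨s - 1, by omega⟩
    rw [iteratedDeriv_succ', deriv_taylorRemainder (hσ.differentiable (by simp))]
    exact ih hσ.deriv' (by omega)

theorem exists_abs_le_mul_pow {φ : ℝ → ℝ} (hφ : ContDiff ℝ ∞ φ) (B : ℝ) {r : ℕ}
    (hr : ∀ l < r, iteratedDeriv l φ 0 = 0) :
    ∃ C, 0 ≤ C ∧ ∀ y, |y| ≤ B → |φ y| ≤ C * |y| ^ r := by
  induction r generalizing φ with
  | zero =>
    obtain ⟨C, hC⟩ := (isCompact_Icc (a := -B) (b := B)).exists_bound_of_continuousOn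
      hφ.continuous.continuousOn
    exact ⟨|C|, abs_nonneg C, fun y hy => by
      simpa using (hC y (abs_le.1 hy)).trans (le_abs_self C)⟩
  | succ r ih =>
    obtain ⟨C, hC, hφ'C⟩ := ih (φ := deriv φ) hφ.deriv' fun l hl => by
      rw [← iteratedDeriv_succ']
      exact hr (l + 1) (by omega)
    refine ⟨C, hC, fun y hy => ?_⟩
    have hφ0 : φ 0 = 0 := hr 0 r.succ_pos
    have hbound : ∀ t ∈ Metric.closedBall (0 : ℝ) |y|, ‖deriv φ t‖ ≤ C * |y| ^ r := fun t ht => by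
      have hty : |t| ≤ |y| := mem_closedBall_zero_iff.1 ht
      exact (hφ'C t (hty.trans hy)).trans (by gcongr)
    have hmvt := (convex_closedBall (0 : ℝ) |y|).norm_image_sub_le_of_norm_deriv_le
      (x := 0) (y := y) (fun t _ => hφ.differentiable (by simp) t) hbound (by simp) (by simp)
    rwa [hφ0, sub_zero, sub_zero, Real.norm_eq_abs, Real.norm_eq_abs, mul_assoc, ← pow_succ] at hmvt

theorem exists_abs_comp_mul_le {X : Type*} {Q : Set X} {S : X → ℝ} {B : ℝ} (hB : 0 ≤ B)
    (hS : ∀ z ∈ Q, |S z| ≤ B) {φ : ℝ → ℝ} (hφ : ContDiff ℝ ∞ φ) {r : ℕ}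
    (hr : ∀ l < r, iteratedDeriv l φ 0 = 0) :
    ∃ C, 0 ≤ C ∧ ∀ δ ∈ Ioc (0 : ℝ) 1, ∀ z ∈ Q, |φ (δ * S z)| ≤ C * δ ^ r := by
  obtain ⟨C, hC, hφC⟩ := exists_abs_le_mul_pow hφ B hr
  refine ⟨C * B ^ r, by positivity, fun δ ⟨hδ0, hδ1⟩ z hz => ?_⟩
  have hδS : |δ * S z| ≤ δ * B := by
    rw [abs_mul, abs_of_pos hδ0]
    exact mul_le_mul_of_nonneg_left (hS z hz) hδ0.le
  calc |φ (δ * S z)| ≤ C * |δ * S z| ^ r := hφC _ (hδS.trans (mul_le_of_le_one_left hB hδ1))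
    _ ≤ C * (δ * B) ^ r := by gcongr
    _ = C * B ^ r * δ ^ r := by rw [mul_pow]; ring

variable {V : Type*} [NormedAddCommGroup V] [NormedSpace ℝ V] {ι : Type*} {dir : ι → V}
  {Q : Set V} {S : V → ℝ} {B : ℝ} {k : ℕ}

theorem BoundedDerivs.exists_comp_mul (hB : 0 ≤ B) (hS : BoundedDerivs dir Q B k S) {φ : ℝ → ℝ}
    (hφ : ContDiff ℝ ∞ φ) {r : ℕ} (hr : ∀ l < r, iteratedDeriv l φ 0 = 0) :
    ∃ C, 0 ≤ C ∧ ∀ δ ∈ Ioc (0 : ℝ) 1, BoundedDerivs dir Q (C * δ ^ r) k fun z => φ (δ * S z) := by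
  obtain ⟨C₀, hC₀, hφC₀⟩ := exists_abs_comp_mul_le hB hS.abs_le hφ hr
  induction k generalizing φ r C₀ with
  | zero => exact ⟨C₀, hC₀, fun δ hδ =>
      ⟨hφ.continuous.comp_continuousOn (continuousOn_const.mul hS.1), hφC₀ δ hδ⟩⟩
  | succ k ih =>
    have hr' : ∀ l < r - 1, iteratedDeriv l (deriv φ) 0 = 0 := fun l hl => by
      rw [← iteratedDeriv_succ']
      exact hr (l + 1) (by omega)
    obtain ⟨C₁, hC₁, hφ'C₁⟩ := exists_abs_comp_mul_le hB hS.abs_le hφ.deriv' hr'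
    obtain ⟨C₂, hC₂, hφ'C₂⟩ := ih hS.of_succ hφ.deriv' hr' C₁ hC₁ hφ'C₁
    obtain ⟨-, S', hS', hS'B⟩ := hS
    refine ⟨C₀ + 2 ^ k * (C₂ * B), by positivity, fun δ hδ => ?_⟩
    have hδ0 : 0 < δ := hδ.1
    refine ⟨fun z hz => (hφC₀ δ hδ z hz).trans ?_, fun z => deriv φ (δ * S z) • δ • S' z,
      fun z hz => (hφ.differentiable (by simp) _).hasDerivAt.comp_hasFDerivWithinAt z
        ((hS' z hz).const_mul δ), fun i => ?_⟩
    · exact mul_le_mul_of_nonneg_right (le_add_of_nonneg_right (by positivity)) (by positivity)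
    · have hprod := (BoundedDerivs.mul (by positivity) hB (hφ'C₂ δ hδ) (hS'B i)).const_mul δ
      refine (hprod.mono_bound ?_).congr fun z _ => mul_left_comm _ _ _
      have hpow : δ * δ ^ (r - 1) ≤ δ ^ r := by
        rw [← pow_succ']
        exact pow_le_pow_of_le_one hδ0.le hδ.2 (by omega)
      calc |δ| * (2 ^ k * (C₂ * δ ^ (r - 1) * B))
          = 2 ^ k * (C₂ * B) * (δ * δ ^ (r - 1)) := by rw [abs_of_pos hδ0]; ring
        _ ≤ 2 ^ k * (C₂ * B) * δ ^ r := by gcongr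
        _ ≤ (C₀ + 2 ^ k * (C₂ * B)) * δ ^ r := by gcongr; linarith

/-- To first order at `b₀` the activation is affine, so one neuron with a small input weight `δ`
passes `S` on through a further layer. -/
theorem BoundedDerivs.exists_approx_id (hB : 0 ≤ B) (hS : BoundedDerivs dir Q B k S) {σ : ℝ → ℝ}
    (hσ : ContDiff ℝ ∞ σ) {b₀ : ℝ} (hb₀ : deriv σ b₀ ≠ 0) {η : ℝ} (hη : 0 < η) :
    ∃ δ v c : ℝ, BoundedDerivs dir Q η k fun z => S z - (v * σ (δ * S z + b₀) + c) := by
  obtain ⟨C, -, hrem⟩ := hS.exists_comp_mul hB (contDiff_taylorRemainder hσ b₀ 1)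
    fun _ h => iteratedDeriv_taylorRemainder hσ b₀ h
  have hlim : Filter.Tendsto (fun δ : ℝ => C * δ / |deriv σ b₀|) (𝓝[>] 0) (𝓝 0) := by
    have hcont : Continuous fun δ : ℝ => C * δ / |deriv σ b₀| := by fun_prop
    simpa using (hcont.tendsto 0).mono_left nhdsWithin_le_nhds
  obtain ⟨δ, hδη, hδ⟩ := ((hlim.eventually_le_const hη).and (Ioc_mem_nhdsGT zero_lt_one)).exists
  have hδ0 : 0 < δ := hδ.1
  refine ⟨δ, 1 / (δ * deriv σ b₀), -(σ b₀ / (δ * deriv σ b₀)),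
    (((hrem δ hδ).const_mul (-(1 / (δ * deriv σ b₀)))).mono_bound ?_).congr fun z _ => ?_⟩
  · refine le_trans (le_of_eq ?_) hδη
    rw [abs_neg, abs_div, abs_one, abs_mul, abs_of_pos hδ0]
    field_simp
    ring
  · have htaylor : taylorRemainder σ b₀ 1 (δ * S z) =
        σ (δ * S z + b₀) - (σ b₀ + deriv σ b₀ * (δ * S z)) := by
      simp [taylorRemainder_eq, Finset.sum_range_succ, add_comm b₀]
    simp only [htaylor]
    field_simp
    ring

end Activation

/-! ### Approximation of polynomials by shallow networks -/

section TensorDifference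

variable {R : Type*} [CommSemiring R] {ι κ : Type*} [Fintype ι] [Fintype κ]

theorem exists_lt_of_sum_le_of_ne {γ α : ι → ℕ} (h : ∑ i, γ i ≤ ∑ i, α i) (hne : γ ≠ α) :
    ∃ i, γ i < α i := by
  by_contra! hαγ
  have heq := (Finset.sum_eq_sum_iff_of_le fun i _ => hαγ i).1
    ((Finset.sum_le_sum fun i _ => hαγ i).antisymm h)
  exact hne (funext fun i => (heq i (Finset.mem_univ i)).symm)

variable {α : ι → ℕ} {c : ι → κ → R} {t : κ → R}

theorem prod_sum_mul_pow_eq_ite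
    (hc : ∀ i, ∀ j ≤ α i, ∑ b, c i b * t b ^ j = if j = α i then 1 else 0) {γ : ι → ℕ}
    (hγ : ∑ i, γ i ≤ ∑ i, α i) :
    ∏ i, ∑ b, c i b * t b ^ γ i = if γ = α then 1 else 0 := by
  split_ifs with h
  · exact Finset.prod_eq_one fun i _ => by rw [h, hc i _ le_rfl, if_pos rfl]
  · obtain ⟨i, hi⟩ := exists_lt_of_sum_le_of_ne hγ h
    exact Finset.prod_eq_zero (Finset.mem_univ i) (by rw [hc i _ hi.le, if_neg hi.ne])

variable [DecidableEq ι]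

theorem sum_prod_mul_prod_pow (c : ι → κ → R) (t : κ → R) (x : ι → R) (γ : ι → ℕ) :
    ∑ β : ι → κ, (∏ i, c i (β i)) * ∏ i, (t (β i) * x i) ^ γ i =
      (∏ i, ∑ b, c i b * t b ^ γ i) * ∏ i, x i ^ γ i := by
  simp only [Fintype.prod_sum, Finset.sum_mul, mul_pow, Finset.prod_mul_distrib, mul_assoc]

theorem sum_prod_mul_sum_pow
    (hc : ∀ i, ∀ j ≤ α i, ∑ b, c i b * t b ^ j = if j = α i then 1 else 0) (x : ι → R) {j : ℕ}
    (hj : j ≤ ∑ i, α i) :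
    ∑ β : ι → κ, (∏ i, c i (β i)) * (∑ i, t (β i) * x i) ^ j =
      if j = ∑ i, α i then Nat.multinomial Finset.univ α * ∏ i, x i ^ α i else 0 := by
  have hsummand : ∀ γ ∈ Finset.piAntidiag Finset.univ j,
      ∑ β : ι → κ, (∏ i, c i (β i)) *
        (Nat.multinomial Finset.univ γ * ∏ i, (t (β i) * x i) ^ γ i) =
      if γ = α then Nat.multinomial Finset.univ α * ∏ i, x i ^ α i else 0 := fun γ hγ => by
    simp only [mul_left_comm _ (Nat.multinomial _ _ : R), ← Finset.mul_sum, sum_prod_mul_prod_pow]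
    rw [prod_sum_mul_pow_eq_ite hc ((Finset.mem_piAntidiag.1 hγ).1.trans_le hj)]
    split_ifs with h
    · rw [h, one_mul]
    · rw [zero_mul, mul_zero]
  simp only [Finset.sum_pow_eq_sum_piAntidiag, Finset.mul_sum]
  rw [Finset.sum_comm, Finset.sum_congr rfl hsummand, Finset.sum_ite_eq']
  simp [eq_comm]

end TensorDifference

section Monomial

variable {ι : Type*} [Fintype ι] {V : Type*} [NormedAddCommGroup V] [NormedSpace ℝ V]
  {ι' : Type*} [Finite ι'] {dir : ι' → V} {Q : Set V} {co : ι → V →L[ℝ] ℝ} {b : ℝ}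

theorem BoundedDerivs.exists_sum_mul (hb : 0 ≤ b) (hQ : ∀ z ∈ Q, ∀ i, |co i z| ≤ b) (a : ι → ℝ)
    (k : ℕ) : ∃ B, 0 ≤ B ∧ BoundedDerivs dir Q B k fun z => ∑ i, a i * co i z := by
  have hbound : ∀ z ∈ Q, |∑ i, a i * co i z| ≤ ∑ i, |a i| * b := fun z hz =>
    (Finset.abs_sum_le_sum_abs _ _).trans (Finset.sum_le_sum fun i _ => by
      rw [abs_mul]
      exact mul_le_mul_of_nonneg_left (hQ z hz i) (abs_nonneg _))
  have hderiv : ∀ z, HasFDerivAt (fun z => ∑ i, a i * co i z) (∑ i, a i • co i) z := fun z =>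
    HasFDerivAt.fun_sum fun i _ => (co i).hasFDerivAt.const_mul (a i)
  cases k with
  | zero => exact ⟨_, by positivity, by fun_prop, hbound⟩
  | succ k =>
    exact BoundedDerivs.exists_succ (by positivity) hbound
      (fun z _ => (hderiv z).hasFDerivWithinAt) fun _ => ⟨_, abs_nonneg _, .const _ le_rfl⟩

variable [DecidableEq ι]

/-- The tensor-product divided difference annihilates all but one of the terms of degree at most
`∑ i, α i` in the Taylor expansion of `σ` at `b₀`. -/
theorem sum_prod_mul_comp_eq {κ : Type*} [Fintype κ] {α : ι → ℕ} {c : ι → κ → ℝ} {t : κ → ℝ}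
    (hc : ∀ i, ∀ j ≤ α i, ∑ b, c i b * t b ^ j = if j = α i then 1 else 0) (σ : ℝ → ℝ)
    (b₀ ε : ℝ) (x : ι → ℝ) :
    ∑ β : ι → κ, (∏ i, c i (β i)) * σ (b₀ + ε * ∑ i, t (β i) * x i) =
      iteratedDeriv (∑ i, α i) σ b₀ / (∑ i, α i).factorial * Nat.multinomial Finset.univ α *
          ε ^ (∑ i, α i) * ∏ i, x i ^ α i +
        ∑ β : ι → κ, (∏ i, c i (β i)) *
          taylorRemainder σ b₀ (∑ i, α i) (ε * ∑ i, t (β i) * x i) := by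
  rw [← sub_eq_iff_eq_add, ← Finset.sum_sub_distrib]
  simp only [taylorRemainder_eq, ← mul_sub, sub_sub_cancel, Finset.mul_sum _ _ (∏ i, c i _)]
  have hterm : ∀ j ∈ Finset.range (∑ i, α i + 1), ∑ β : ι → κ, (∏ i, c i (β i)) *
      (iteratedDeriv j σ b₀ / j.factorial * (ε * ∑ i, t (β i) * x i) ^ j) =
      if j = ∑ i, α i then iteratedDeriv (∑ i, α i) σ b₀ / (∑ i, α i).factorial *
        Nat.multinomial Finset.univ α * ε ^ (∑ i, α i) * ∏ i, x i ^ α i else 0 := fun j hj => by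
    have hfactor : ∀ β : ι → κ, (∏ i, c i (β i)) *
        (iteratedDeriv j σ b₀ / j.factorial * (ε * ∑ i, t (β i) * x i) ^ j) =
        iteratedDeriv j σ b₀ / j.factorial * ε ^ j *
          ((∏ i, c i (β i)) * (∑ i, t (β i) * x i) ^ j) := fun β => by rw [mul_pow]; ring
    simp only [hfactor, ← Finset.mul_sum]
    rw [sum_prod_mul_sum_pow hc x (Nat.lt_succ_iff.1 (Finset.mem_range.1 hj))]
    split_ifs with h
    · rw [h]; ring
    · rw [mul_zero]
  rw [Finset.sum_comm, Finset.sum_congr rfl hterm, Finset.sum_ite_eq', if_pos (by simp)]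

theorem eventually_exists_approx_monomial (hb : 0 ≤ b) (hQ : ∀ z ∈ Q, ∀ i, |co i z| ≤ b)
    {σ : ℝ → ℝ} (hσ : ContDiff ℝ ∞ σ) {b₀ : ℝ} {n : ℕ} {t : Fin (n + 1) → ℝ}
    (ht : Function.Injective t) {α : ι → ℕ} (hα : ∀ i, α i ≤ n)
    (hσα : iteratedDeriv (∑ i, α i) σ b₀ ≠ 0) (k : ℕ) {η : ℝ} (hη : 0 < η) :
    ∀ᶠ ε in 𝓝[>] (0 : ℝ), ∃ a : (ι → Fin (n + 1)) → ℝ, BoundedDerivs dir Q η k fun z =>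
      ∏ i, co i z ^ α i - ∑ β, a β * σ (b₀ + ε * ∑ i, t (β i) * co i z) := by
  choose c hc using fun i => exists_interpolation_coeffs ht (α i)
  choose B hB hBl using fun β : ι → Fin (n + 1) =>
    BoundedDerivs.exists_sum_mul (dir := dir) hb hQ (fun i => t (β i)) k
  choose C _ hCrem using fun β => (hBl β).exists_comp_mul (hB β)
    (contDiff_taylorRemainder hσ b₀ (∑ i, α i)) fun _ h => iteratedDeriv_taylorRemainder hσ b₀ h
  obtain ⟨s, hs⟩ : ∃ s, s = ∑ i, α i := ⟨_, rfl⟩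
  have hexpand := fun ε z =>
    sum_prod_mul_comp_eq (fun i j hj => hc i j (hj.trans (hα i))) σ b₀ ε fun i => co i z
  rw [← hs] at hσα
  simp only [← hs] at hCrem hexpand
  generalize hθ : iteratedDeriv s σ b₀ / s.factorial * Nat.multinomial Finset.univ α = θ at hexpand
  have hθ0 : θ ≠ 0 := hθ ▸ mul_ne_zero (div_ne_zero hσα (by positivity))
    (Nat.cast_ne_zero.2 (Nat.multinomial_pos _ _).ne')
  have hlim : Filter.Tendsto
      (fun ε : ℝ => ∑ β : ι → Fin (n + 1), |∏ i, c i (β i)| * (C β * ε) / |θ|) (𝓝[>] 0) (𝓝 0) := by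
    have hcont : Continuous fun ε : ℝ =>
      ∑ β : ι → Fin (n + 1), |∏ i, c i (β i)| * (C β * ε) / |θ| := by fun_prop
    simpa using (hcont.tendsto 0).mono_left nhdsWithin_le_nhds
  filter_upwards [hlim.eventually_le_const hη, Ioc_mem_nhdsGT zero_lt_one] with ε hεη hε
  have hε0 : 0 < ε := hε.1
  have hsum := BoundedDerivs.sum Finset.univ fun β _ =>
    (hCrem β ε hε).const_mul (-((∏ i, c i (β i)) / (θ * ε ^ s)))
  refine ⟨fun β => (∏ i, c i (β i)) / (θ * ε ^ s),
    (hsum.mono_bound (le_trans (le_of_eq ?_) hεη)).congr fun z _ => ?_⟩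
  · refine Finset.sum_congr rfl fun β _ => ?_
    rw [abs_neg, abs_div, abs_mul, abs_of_pos (pow_pos hε0 s), pow_succ]
    field_simp
  · simp only [neg_mul, div_mul_eq_mul_div, Finset.sum_neg_distrib, ← Finset.sum_div, hexpand]
    field_simp
    ring

theorem exists_approx_polynomial (hb : 0 ≤ b) (hQ : ∀ z ∈ Q, ∀ i, |co i z| ≤ b) {σ : ℝ → ℝ}
    (hσ : ContDiff ℝ ∞ σ) {b₀ : ℝ} {n : ℕ} {t : Fin (n + 1) → ℝ} (ht : Function.Injective t)
    (hσ₀ : ∀ j ≤ Fintype.card ι * n, iteratedDeriv j σ b₀ ≠ 0) (k : ℕ)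
    (p : (ι → Fin (n + 1)) → ℝ) {η : ℝ} (hη : 0 < η) :
    ∃ (ε : ℝ) (a : (ι → Fin (n + 1)) → ℝ), BoundedDerivs dir Q η k fun z =>
      ∑ α, p α * ∏ i, co i z ^ (α i : ℕ) -
        ∑ β, a β * σ (b₀ + ε * ∑ i, t (β i) * co i z) := by
  have hdeg : ∀ α : ι → Fin (n + 1), ∑ i, (α i : ℕ) ≤ Fintype.card ι * n := fun α =>
    (Finset.sum_le_sum fun i _ => Fin.is_le (α i)).trans (by simp)
  obtain ⟨ε, hε⟩ := (Filter.eventually_all.2 fun α : ι → Fin (n + 1) =>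
    eventually_exists_approx_monomial (dir := dir) hb hQ hσ ht (fun i => Fin.is_le (α i))
      (hσ₀ _ (hdeg α)) k (η := η / (∑ α, |p α| + 1)) (by positivity)).exists
  choose a ha using hε
  have hsum := BoundedDerivs.sum Finset.univ fun α _ => (ha α).const_mul (p α)
  refine ⟨ε, fun β => ∑ α, p α * a α β, (hsum.mono_bound ?_).congr fun z _ => ?_⟩
  · rw [← Finset.sum_mul, mul_div_assoc', div_le_iff₀ (by positivity)]
    nlinarith
  · simp only [mul_sub, Finset.sum_sub_distrib, Finset.mul_sum, Finset.sum_mul, ← mul_assoc]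
    rw [Finset.sum_comm]

end Monomial

/-! ### Networks with two hidden layers and prescribed complexity -/

section Network

open Classical in
theorem ncard_cons_ne_zero {α : Type*} [Zero α] {n : ℕ} (x : α) (g : Fin n → α) :
    {i | (Fin.cons x g : Fin (n + 1) → α) i ≠ 0}.ncard =
      (if x = 0 then 0 else 1) + {i | g i ≠ 0}.ncard := by
  simp only [Set.ncard_eq_toFinset_card', Set.toFinset_ofPred, Finset.card_filter,
    Fin.sum_univ_succ, Fin.cons_zero, Fin.cons_succ, ite_not]

theorem ncard_of_cons_zero_ne_zero {α : Type*} [Zero α] {m n : ℕ} (a : Fin m → α) :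
    {p : Fin (n + 1) × Fin m | Matrix.of (Fin.cons a 0) p.1 p.2 ≠ 0}.ncard =
      {j | a j ≠ 0}.ncard := by
  have himage : {p : Fin (n + 1) × Fin m | Matrix.of (Fin.cons a 0) p.1 p.2 ≠ 0} =
      Prod.mk 0 '' {j | a j ≠ 0} := by
    ext ⟨i, j⟩
    cases i using Fin.cases with
    | zero => simp
    | succ i => simp [(Fin.succ_ne_zero i).symm]
  rw [himage, Set.ncard_image_of_injective _ (Prod.mk_right_injective 0)]

namespace NeuralNetwork

section Padded

variable {D m : ℕ} (W : Matrix (Fin m) (Fin D) ℝ) (b₁ a : Fin m → ℝ) (b₂ v c : ℝ) (P : ℕ)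

/-- A network with two hidden layers, the second of which has one active neuron with input weights
`a`, bias `b₂` and output weight `v`. It is followed by `P` idle neurons, of bias `1` and with no
other nonzero weight, which raise the complexity to a prescribed value. -/
def padded : NeuralNetwork D :=
  .hidden W b₁ (.hidden (Matrix.of (Fin.cons a 0 : Fin (P + 1) → Fin m → ℝ)) (Fin.cons b₂ 1)
    (.output (Fin.cons v 0) c))

theorem depth_padded : (padded W b₁ a b₂ v c P).depth = 2 :=
  rfl

theorem eval_padded (σ : ℝ → ℝ) (x : Fin D → ℝ) :
    (padded W b₁ a b₂ v c P).eval σ x =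
      v * σ (∑ i, a i * σ (W.mulVec x i + b₁ i) + b₂) + c := by
  simp [padded, eval, dotProduct, Fin.sum_univ_succ, Matrix.mulVec]

theorem complexity_padded :
    (padded W b₁ a b₂ v c P).complexity = (padded W b₁ a b₂ v c 0).complexity + P := by
  have hcard : {i : Fin P | (1 : Fin P → ℝ) i ≠ 0}.ncard = P := by simp [Set.ncard_univ]
  have hcard₀ (n : ℕ) : {i : Fin n | (0 : Fin n → ℝ) i ≠ 0}.ncard = 0 := by simp
  have hcard₁ : {i : Fin 0 | (1 : Fin 0 → ℝ) i ≠ 0}.ncard = 0 := by simp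
  simp only [padded, complexity, ncard_of_cons_zero_ne_zero, ncard_cons_ne_zero, hcard, hcard₀,
    hcard₁]
  ring

theorem complexity_padded_zero_le :
    (padded W b₁ a b₂ v c 0).complexity ≤ m * (D + 2) + 3 := by
  have hweights := Set.ncard_le_card {p : Fin m × Fin D | W p.1 p.2 ≠ 0}
  have hbiases := Set.ncard_le_card {i | b₁ i ≠ 0}
  have houtputs := Set.ncard_le_card {i | a i ≠ 0}
  simp only [Nat.card_prod, Nat.card_fin] at hweights hbiases houtputs
  simp only [padded, complexity, ncard_of_cons_zero_ne_zero, ncard_cons_ne_zero]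
  split_ifs <;> simp <;> linarith

end Padded

theorem exists_of_card_le {D : ℕ} {κ : Type*} [Fintype κ] {N : ℕ} (W : κ → Fin D → ℝ)
    (b₁ a : κ → ℝ) (b₂ v c : ℝ) (hN : Fintype.card κ * (D + 2) + 3 ≤ N) :
    ∃ Φ : NeuralNetwork D, 2 ≤ Φ.depth ∧ Φ.complexity = N ∧ ∀ (σ : ℝ → ℝ) (x : Fin D → ℝ),
      Φ.eval σ x = v * σ (∑ q, a q * σ (∑ i, W q i * x i + b₁ q) + b₂) + c := by
  let e := (Fintype.equivFin κ).symm
  refine ⟨padded (Matrix.of fun q => W (e q)) (b₁ ∘ e) (a ∘ e) b₂ v c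
    (N - (padded (Matrix.of fun q => W (e q)) (b₁ ∘ e) (a ∘ e) b₂ v c 0).complexity),
    (depth_padded ..).ge, ?_, fun σ x => ?_⟩
  · rw [complexity_padded, Nat.add_sub_cancel' ((complexity_padded_zero_le ..).trans hN)]
  · rw [eval_padded, ← e.sum_comp]
    rfl

theorem exists_eval_eq_zero (D N : ℕ) :
    ∃ Φ : NeuralNetwork D, 2 ≤ Φ.depth ∧ Φ.complexity = N ∧
      ∀ (σ : ℝ → ℝ) (x : Fin D → ℝ), Φ.eval σ x = 0 := by
  refine ⟨padded (0 : Matrix (Fin 0) (Fin D) ℝ) 0 0 0 0 0 N, (depth_padded ..).ge, ?_,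
    fun σ x => by rw [eval_padded, zero_mul, add_zero]⟩
  rw [complexity_padded]
  simp [padded, complexity, ncard_cons_ne_zero, Set.eq_empty_of_isEmpty]

end NeuralNetwork

end Network

/-! ### Approximation by neural networks -/

section Approximation

variable {d : ℕ}

theorem coordFun_sum_smul_coordDir (u : Fin (d + 1) → ℝ) (i : Fin (d + 1)) :
    coordFun d i (∑ j, u j • coordDir d j) = u i := by
  rw [Fin.sum_univ_succ]
  simp only [coordFun, coordDir, Fin.cons_zero, Fin.cons_succ]
  cases i using Fin.cases with
  | zero => simp [Prod.fst_sum]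
  | succ i => simp [Prod.snd_sum]

theorem abs_coordFun_le (i : Fin (d + 1)) (z : SpaceTime d) : |coordFun d i z| ≤ ‖z‖ := by
  cases i using Fin.cases with
  | zero => exact norm_fst_le z
  | succ i => exact (PiLp.norm_apply_le z.2 i).trans (norm_snd_le z)

theorem cons_eq_coordFun (z : SpaceTime d) :
    (Fin.cons z.1 (fun i => z.2 i) : Fin (d + 1) → ℝ) = fun i => coordFun d i z :=
  funext fun i => Fin.cases rfl (fun _ => rfl) i

theorem NeuralNetwork.exists_realize_eq {n N : ℕ} (t : Fin (n + 1) → ℝ)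
    (a : (Fin (d + 1) → Fin (n + 1)) → ℝ) (b₀ ε δ v c : ℝ)
    (hN : (d + 3) * (n + 1) ^ (d + 1) + 3 ≤ N) :
    ∃ Φ : NeuralNetwork (d + 1), 2 ≤ Φ.depth ∧ Φ.complexity = N ∧
      ∀ (σ : ℝ → ℝ) (z : SpaceTime d), Φ.realize σ z =
        v * σ (δ * ∑ β, a β * σ (b₀ + ε * ∑ i, t (β i) * coordFun d i z) + b₀) + c := by
  obtain ⟨Φ, hdepth, hcomplexity, heval⟩ := NeuralNetwork.exists_of_card_le (N := N)
    (fun β i => ε * t (β i)) (fun _ : Fin (d + 1) → Fin (n + 1) => b₀) (fun β => δ * a β) b₀ v c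
    (by simpa [mul_comm] using hN)
  refine ⟨Φ, hdepth, hcomplexity, fun σ z => ?_⟩
  simp only [NeuralNetwork.realize, heval, cons_eq_coordFun, Finset.mul_sum, mul_assoc,
    add_comm b₀]

theorem BoundedDerivs.exists_network_approx {k n N : ℕ} {b M η : ℝ} (hb : 0 < b) (hM : 0 ≤ M)
    (hη : 0 < η) {σ : ℝ → ℝ} (hσ : ContDiff ℝ ∞ σ) (hp : ¬ ∃ p : Polynomial ℝ, ∀ y, σ y = p.eval y)
    {F : SpaceTime d → ℝ} (hF : BoundedDerivs (coordDir d) univ M (k + 1) F)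
    (hsupp : ∀ z, F z ≠ 0 → ∀ i, |coordFun d i z| ≤ b) (hn : 1 ≤ n)
    (hN : (d + 3) * (8 * n + 1) ^ (d + 1) + 3 ≤ N) :
    ∃ Φ : NeuralNetwork (d + 1), 2 ≤ Φ.depth ∧ Φ.complexity = N ∧
      BoundedDerivs (coordDir d) {z | ∀ i, |coordFun d i z| ≤ b}
        ((d + 1) * (129 * (2 * b) / n) * M + η) k (fun z => F z - Φ.realize σ z) := by
  obtain ⟨U, -, ⟨b₀, hb₀U⟩, hU⟩ := exists_isOpen_iteratedDeriv_ne_zero hσ hp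
    (Fintype.card (Fin (d + 1)) * (8 * n))
  have hb₀ := hU b₀ hb₀U
  have hderiv : deriv σ b₀ ≠ 0 := iteratedDeriv_one (f := σ) ▸ hb₀ 1 (by simp; nlinarith)
  have hnodes : Function.Injective fun j : Fin (8 * n + 1) => ((j : ℕ) : ℝ) :=
    Nat.cast_injective.comp Fin.val_injective
  obtain ⟨p, hpoly⟩ := hF.exists_polynomial_approx hb hM sum_coordFun_smul_coordDir
    coordFun_sum_smul_coordDir hsupp hn
  obtain ⟨ε, a, hshallow⟩ := exists_approx_polynomial (dir := coordDir d) (co := coordFun d)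
    (Q := {z | ∀ i, |coordFun d i z| ≤ b}) hb.le (fun z hz => hz) hσ hnodes hb₀ k p
    (half_pos hη)
  obtain ⟨S, hS⟩ : ∃ S : SpaceTime d → ℝ, S = fun z =>
    ∑ β, a β * σ (b₀ + ε * ∑ i, ((β i : ℕ) : ℝ) * coordFun d i z) := ⟨_, rfl⟩
  have hFS : BoundedDerivs (coordDir d) {z | ∀ i, |coordFun d i z| ≤ b}
      (Fintype.card (Fin (d + 1)) * (129 * (2 * b) / n) * M + η / 2) k fun z => F z - S z :=
    (hpoly.add hshallow).congr fun z _ => by simp only [hS]; ring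
  have hSbound := ((hF.of_succ.mono_set (subset_univ _)).sub hFS).congr fun z _ =>
    (sub_sub_cancel (F z) (S z)).symm
  obtain ⟨δ, v, c, hdeep⟩ := hSbound.exists_approx_id (by positivity) hσ hderiv (half_pos hη)
  obtain ⟨Φ, hdepth, hcomplexity, hrealize⟩ := NeuralNetwork.exists_realize_eq
    (fun j : Fin (8 * n + 1) => ((j : ℕ) : ℝ)) a b₀ ε δ v c hN
  refine ⟨Φ, hdepth, hcomplexity, ((hFS.add hdeep).mono_bound (le_of_eq ?_)).congr fun z _ => ?_⟩
  · rw [Fintype.card_fin, add_assoc, add_halves, Nat.cast_succ]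
  · simp only [hrealize, hS, sub_add_sub_cancel]

theorem exists_resolution {c D N : ℕ} (hc : 0 < c) (hD : 0 < D) (hN : 1 ≤ N) :
    1 ≤ (c : ℝ) ^ (1 / (D : ℝ)) * (N : ℝ) ^ (-(1 / (D : ℝ))) ∨
      ∃ n : ℕ, 1 ≤ n ∧ c * n ^ D ≤ N ∧
        1 / (n : ℝ) ≤ 2 * ((c : ℝ) ^ (1 / (D : ℝ)) * (N : ℝ) ^ (-(1 / (D : ℝ)))) := by
  have hc' : (0 : ℝ) < c := by exact_mod_cast hc
  have hN' : (0 : ℝ) < N := by exact_mod_cast hN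
  obtain ⟨x, hx⟩ : ∃ x : ℝ, x = (N / c : ℝ) ^ (1 / (D : ℝ)) := ⟨_, rfl⟩
  have hx0 : 0 < x := hx ▸ by positivity
  have hinv : (c : ℝ) ^ (1 / (D : ℝ)) * (N : ℝ) ^ (-(1 / (D : ℝ))) = 1 / x := by
    rw [hx, Real.div_rpow hN'.le hc'.le, Real.rpow_neg hN'.le, one_div_div, ← div_eq_mul_inv]
  have hxD : x ^ D = (N : ℝ) / c := by
    rw [hx, one_div, Real.rpow_inv_natCast_pow (by positivity) hD.ne']
  rw [hinv]
  refine (le_or_gt x 1).imp (one_le_div hx0).2 fun hx1 => ?_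
  have hfloor : 1 ≤ ⌊x⌋₊ := (Nat.one_le_floor_iff x).2 hx1.le
  have hfloor' : (1 : ℝ) ≤ ⌊x⌋₊ := by exact_mod_cast hfloor
  refine ⟨⌊x⌋₊, hfloor, ?_, ?_⟩
  · have hpow : (⌊x⌋₊ : ℝ) ^ D ≤ N / c :=
      hxD ▸ pow_le_pow_left₀ (Nat.cast_nonneg _) (Nat.floor_le hx0.le) D
    rw [le_div_iff₀' hc'] at hpow
    exact_mod_cast hpow
  · rw [mul_one_div, div_le_div_iff₀ (by linarith) hx0]
    linarith [Nat.lt_floor_add_one x]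

end Approximation

/-! ### The approximation theorem -/

section Main

variable {d : ℕ} {Ω : Set (EuclideanSpace ℝ (Fin d))} {T : ℝ}

theorem HasSmoothBoundary.exists_network_approx (hΩ : HasSmoothBoundary Ω) (hΩo : IsOpen Ω)
    (hΩb : Bornology.IsBounded Ω) (hT : 0 < T) (k : ℕ) :
    ∃ A : ℝ, 1 ≤ A ∧ ∀ σ : ℝ → ℝ, ContDiff ℝ ∞ σ →
      (¬ ∃ p : Polynomial ℝ, ∀ y, σ y = p.eval y) → ∀ (f : SpaceTime d → ℝ) (M : ℝ), 0 < M →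
      BoundedDerivs (coordDir d) (Icc 0 T ×ˢ closure Ω) M (k + 1) f → ∀ n N : ℕ, 1 ≤ n →
      ((d + 3) * 9 ^ (d + 1) + 3) * n ^ (d + 1) ≤ N →
        ∃ Φ : NeuralNetwork (d + 1), 2 ≤ Φ.depth ∧ Φ.complexity = N ∧
          BoundedDerivs (coordDir d) (Icc 0 T ×ˢ closure Ω) (1 / n * A * M) k
            fun z => f z - Φ.realize σ z := by
  obtain ⟨K, R, hK, hextend⟩ := hΩ.exists_extension hΩo hΩb hT (k + 1)
  obtain ⟨R', hR'⟩ := ((Metric.isBounded_Icc 0 T).prod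
    hΩb.isCompact_closure.isBounded).exists_norm_le
  obtain ⟨b, hb, hRb, hRb'⟩ : ∃ b, 0 < b ∧ R ≤ b ∧ R' ≤ b :=
    ⟨max 1 (max R R'), by positivity, by simp, by simp⟩
  refine ⟨(d + 1) * (129 * (2 * b)) * K + 1, le_add_of_nonneg_left (by positivity),
    fun σ hσ hp f M hM hf n N hn hnN => ?_⟩
  obtain ⟨F, hFf, hF, hFsupp⟩ := hextend f M hM.le hf
  have hcount : (d + 3) * (8 * n + 1) ^ (d + 1) + 3 ≤ N := calc
    (d + 3) * (8 * n + 1) ^ (d + 1) + 3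
        ≤ (d + 3) * (9 * n) ^ (d + 1) + 3 * n ^ (d + 1) := by
          gcongr
          · lia
          · exact Nat.le_mul_of_pos_right _ (Nat.pow_pos hn)
    _ = ((d + 3) * 9 ^ (d + 1) + 3) * n ^ (d + 1) := by rw [mul_pow]; ring
    _ ≤ N := hnN
  have hn0 : (0 : ℝ) < n := by exact_mod_cast hn
  obtain ⟨Φ, hdepth, hcomplexity, happrox⟩ := hF.exists_network_approx hb
    (mul_nonneg hK hM.le) (div_pos hM hn0) hσ hp
    (fun z hz i => (abs_coordFun_le i z).trans ((hFsupp z hz).trans hRb)) hn hcount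
  refine ⟨Φ, hdepth, hcomplexity, ((happrox.mono_set fun z hz i =>
    (abs_coordFun_le i z).trans ((hR' z hz).trans hRb')).mono_bound (le_of_eq ?_)).congr
      fun z hz => by simp only [hFf hz]⟩
  ring

theorem HasSmoothBoundary.exists_network_sobolevNorm_le (hΩ : HasSmoothBoundary Ω)
    (hΩo : IsOpen Ω) (hΩb : Bornology.IsBounded Ω) (hT : 0 < T) (k : ℕ) :
    ∃ A : ℝ, 1 ≤ A ∧ ∀ σ : ℝ → ℝ, ContDiff ℝ ∞ σ →
      (¬ ∃ p : Polynomial ℝ, ∀ y, σ y = p.eval y) → ∀ f : SpaceTime d → ℝ,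
      ContDiffOn ℝ (k + 1) f (Icc 0 T ×ˢ closure Ω) →
      sobolevNorm (k + 1) (Ioo 0 T ×ˢ Ω) f ≠ 0 → sobolevNorm (k + 1) (Ioo 0 T ×ˢ Ω) f ≠ ⊤ →
      ∀ n N : ℕ, 1 ≤ n → ((d + 3) * 9 ^ (d + 1) + 3) * n ^ (d + 1) ≤ N →
        ∃ Φ : NeuralNetwork (d + 1), 2 ≤ Φ.depth ∧ Φ.complexity = N ∧
          sobolevNorm k (Ioo 0 T ×ˢ Ω) (fun z => f z - Φ.realize σ z) ≤
            ENNReal.ofReal (1 / n * A) * sobolevNorm (k + 1) (Ioo 0 T ×ˢ Ω) f := by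
  have hQo : IsOpen (Ioo 0 T ×ˢ Ω) := isOpen_Ioo.prod hΩo
  have hQS : Ioo 0 T ×ˢ Ω ⊆ Icc 0 T ×ˢ closure Ω := prod_mono Ioo_subset_Icc_self subset_closure
  have hSQ : Icc 0 T ×ˢ closure Ω ⊆ closure (Ioo 0 T ×ˢ Ω) := by
    rw [closure_prod_eq, closure_Ioo hT.ne]
  have hS : UniqueDiffOn ℝ (Icc 0 T ×ˢ closure Ω) :=
    (uniqueDiffOn_Icc hT).prod (hΩ.uniqueDiffOn_closure hΩo)
  obtain ⟨A, hA, happrox⟩ := hΩ.exists_network_approx hΩo hΩb hT k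
  refine ⟨A, hA, fun σ hσ hp f hf hzero htop n N hn hnN => ?_⟩
  have hbounded := boundedDerivs_of_sobolevNorm_le hQo hQS hSQ hS ENNReal.toReal_nonneg
    (by exact_mod_cast hf) (ENNReal.ofReal_toReal htop).ge
  obtain ⟨Φ, hdepth, hcomplexity, hΦ⟩ :=
    happrox σ hσ hp f _ (ENNReal.toReal_pos hzero htop) hbounded n N hn hnN
  refine ⟨Φ, hdepth, hcomplexity, ((hΦ.mono_set hQS).sobolevNorm_le hQo).trans (le_of_eq ?_)⟩
  rw [ENNReal.ofReal_mul (by positivity), ENNReal.ofReal_toReal htop]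

theorem exists_network_sobolevNorm_sub_le (k : ℕ) (Q : Set (SpaceTime d)) (σ : ℝ → ℝ)
    (f : SpaceTime d → ℝ) (N : ℕ) :
    ∃ Φ : NeuralNetwork (d + 1), 2 ≤ Φ.depth ∧ Φ.complexity = N ∧
      sobolevNorm k Q (fun z => f z - Φ.realize σ z) ≤ sobolevNorm (k + 1) Q f := by
  obtain ⟨Φ, hdepth, hcomplexity, heval⟩ := NeuralNetwork.exists_eval_eq_zero (d + 1) N
  refine ⟨Φ, hdepth, hcomplexity, ?_⟩
  simpa only [NeuralNetwork.realize, heval, sub_zero] using sobolevNorm_mono (Nat.le_succ k) f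

theorem proposition3p1_general (hΩ : HasSmoothBoundary Ω) (hΩo : IsOpen Ω)
    (hΩb : Bornology.IsBounded Ω) (hT : 0 < T) (k : ℕ) :
    ∃ C : ℝ, 0 < C ∧
      ∀ σ : ℝ → ℝ, ContDiff ℝ ∞ σ → (¬ ∃ p : Polynomial ℝ, ∀ y, σ y = p.eval y) →
      ∀ f : SpaceTime d → ℝ, ContDiffOn ℝ (k + 1) f (Icc 0 T ×ˢ closure Ω) →
      ∀ N : ℕ, 1 ≤ N →
        ∃ Φ : NeuralNetwork (d + 1), 2 ≤ Φ.depth ∧ Φ.complexity = N ∧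
          sobolevNorm k (Ioo 0 T ×ˢ Ω) (fun z => f z - Φ.realize σ z) ≤
            ENNReal.ofReal (C * (N : ℝ) ^ (-(1 / ((d : ℝ) + 1)))) *
              sobolevNorm (k + 1) (Ioo 0 T ×ˢ Ω) f := by
  obtain ⟨A, hA, happrox⟩ := hΩ.exists_network_sobolevNorm_le hΩo hΩb hT k
  obtain ⟨c, hc⟩ : ∃ c, c = (d + 3) * 9 ^ (d + 1) + 3 := ⟨_, rfl⟩
  have hc0 : 0 < c := by lia
  refine ⟨2 * (c : ℝ) ^ (1 / ((d : ℝ) + 1)) * A, by positivity, fun σ hσ hp f hf N hN => ?_⟩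
  have hresolution := exists_resolution hc0 d.succ_pos hN
  rw [Nat.cast_succ] at hresolution
  rw [mul_right_comm, mul_assoc 2]
  have hrate : 0 < (c : ℝ) ^ (1 / ((d : ℝ) + 1)) * (N : ℝ) ^ (-(1 / ((d : ℝ) + 1))) := by
    positivity
  generalize (c : ℝ) ^ (1 / ((d : ℝ) + 1)) * (N : ℝ) ^ (-(1 / ((d : ℝ) + 1))) = r
    at hresolution hrate ⊢
  obtain hlarge | hsmall := le_or_gt (sobolevNorm (k + 1) (Ioo 0 T ×ˢ Ω) f)
    (ENNReal.ofReal (2 * r * A) * sobolevNorm (k + 1) (Ioo 0 T ×ˢ Ω) f)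
  · exact (exists_network_sobolevNorm_sub_le k _ σ f N).imp fun Φ hΦ =>
      ⟨hΦ.1, hΦ.2.1, hΦ.2.2.trans hlarge⟩
  · have hzero : sobolevNorm (k + 1) (Ioo 0 T ×ˢ Ω) f ≠ 0 := fun h => by simp [h] at hsmall
    have htop : sobolevNorm (k + 1) (Ioo 0 T ×ˢ Ω) f ≠ ⊤ := fun h => by
      rw [h, ENNReal.mul_top (by positivity)] at hsmall
      exact hsmall.false
    obtain ⟨n, hn, hnN, hnr⟩ := hresolution.resolve_left fun h => hsmall.not_ge
      (le_mul_of_one_le_left zero_le (ENNReal.one_le_ofReal.2 (by nlinarith)))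
    refine (happrox σ hσ hp f hf hzero htop n N hn (hc ▸ hnN)).imp fun Φ hΦ =>
      ⟨hΦ.1, hΦ.2.1, hΦ.2.2.trans ?_⟩
    gcongr

end Main

theorem proposition3p1 (d : ℕ) (Ω : Set (EuclideanSpace ℝ (Fin d)))
    (hΩ : IsSmoothBoundedDomain Ω) (T : ℝ) (hT : 0 < T) (k : ℕ) :
    ∃ C : ℝ, 0 < C ∧
      ∀ σ : ℝ → ℝ, ContDiff ℝ ∞ σ → (¬ ∃ p : Polynomial ℝ, ∀ y, σ y = p.eval y) →
      ∀ f : SpaceTime d → ℝ, ContDiffOn ℝ (k + 1) f (Icc 0 T ×ˢ closure Ω) →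
      ∀ N : ℕ, 1 ≤ N →
        ∃ Φ : NeuralNetwork (d + 1), 2 ≤ Φ.depth ∧ Φ.complexity = N ∧
          sobolevNorm k (Ioo 0 T ×ˢ Ω) (fun z => f z - Φ.realize σ z) ≤
            ENNReal.ofReal (C * (N : ℝ) ^ (-(1 / ((d : ℝ) + 1)))) *
              sobolevNorm (k + 1) (Ioo 0 T ×ˢ Ω) f :=
  proposition3p1_general hΩ.smooth_boundary hΩ.isOpen hΩ.isBounded hT k
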